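/- **Theorem.** For integers $n_1,n_2\ge 1$ and $p\in[0,1]$ let $G(n_1,n_2,p)$ be the random bipartite graph with partition classes of sizes $n_1$ and $n_2$ in which each of the $n_1n_2$ possible edges between the classes is present independently with probability $p$. Let $g(G)$ denote the genus of a graph $G$, i.e. the smallest integer $g\ge 0$ such that $G$ can be embedded on the sphere with $g$ handles. Let $d>1$ and $0<\lambda\le 1$ be constants, let $n_1=\lambda n_2$ with $n_1\to\infty$, let $p=\frac{d}{\sqrt{n_1n_2}}$, and let $G=G(n_1,n_2,p)$. Put $$\gamma(d,\lambda)=\frac12-\frac{\lambda+1}{2d\sqrt\lambda}+\frac1{2d^2}\sum_{k=1}^{\infty}\left(\frac{d}{\sqrt\lambda}\,e^{-\frac{d}{\sqrt\lambda}}\right)^{k}\ \sum_{\substack{r+s=k\\ r,s\ge 0}}\frac{r^{s-1}s^{r-1}}{r!\,s!}\,\lambda^{r}\,e^{-\frac{d(\lambda-1)}{\sqrt\lambda}s},$$ where $0^0=1$. Then the series converges, and with high probability $$g(G)=(1+o(1))\,\gamma(d,\lambda)\,p\,n_1n_2 ;$$ that is, for every $\varepsilon>0$, $$\Pr\bigl(\,|g(G)-\gamma(d,\lambda)pn_1n_2|\le\varepsilon\,\gamma(d,\lambda)pn_1n_2\,\bigr)\to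 1\qquad\text{as } n_1\to\infty .$$ -/

import Mathlib

open Filter Topology MeasureTheory ProbabilityTheory

/-! ### The genus of a finite graph -/

namespace SimpleGraph

/-- A rotation system of a graph `G`: at every vertex `v`, a cyclic order of the darts
(oriented edges) leaving `v`. It is recorded as a permutation `next` of all darts whose cycles are
exactly the nonempty sets of darts with a common initial vertex. -/
structure RotationSystem {V : Type*} (G : SimpleGraph V) where
  /-- the successor of a dart in the cyclic order at its initial vertex -/
  next : Equiv.Perm G.Dart
  /-- `next` keeps the initial vertex -/
  fst_next : ∀ a : G.Dart, (next a).fst = a.fst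
  /-- the darts leaving a vertex form a single cycle -/
  sameCycle : ∀ a b : G.Dart, a.fst = b.fst → next.SameCycle a b

namespace RotationSystem

variable {V : Type*} {G : SimpleGraph V}

/-- The face-tracing permutation: traverse the dart `a = (u, v)` and then leave `v` along the dart
that follows `(v, u)` in the cyclic order at `v`. -/
def facePerm (R : RotationSystem G) : Equiv.Perm G.Dart :=
  SimpleGraph.Dart.symm_involutive.toPerm.trans R.next

/-- The number of faces, counted separately for each connected component of `G`: the cycles of the
face-tracing permutation, and one face for every isolated vertex (which is embedded alone in a
sphere and has no dart to trace). -/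
noncomputable def numFaces (R : RotationSystem G) : ℕ :=
  Nat.card (Quotient (Equiv.Perm.SameCycle.setoid R.facePerm)) + Nat.card {v : V // ∀ w, ¬ G.Adj v w}

/-- The Euler characteristic `v - e + f` of a rotation system. A rotation system embeds each
connected component `C` cellularly in a closed orientable surface, of genus `g_C` given by
`2 - 2 g_C = v_C - e_C + f_C`; this is the sum of these numbers over all components. -/
noncomputable def eulerChar (R : RotationSystem G) : ℤ :=
  (Nat.card V : ℤ) - Nat.card G.edgeSet + R.numFaces

end RotationSystem

/-- The finite graph `G` can be drawn without crossings on the sphere with `g` handles: some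
rotation system of `G` has total genus `∑_C g_C = (2 κ(G) - (v - e + f)) / 2` at most `g`, where
`κ(G)` is the number of connected components. -/
def EmbedsInGenus {V : Type*} (G : SimpleGraph V) (g : ℕ) : Prop :=
  ∃ R : RotationSystem G, 2 * (Nat.card G.ConnectedComponent : ℤ) - R.eulerChar ≤ 2 * g

/-- The (orientable) genus of a finite graph: the smallest `g` such that the graph can be embedded
on the sphere with `g` handles. -/
noncomputable def genus {V : Type*} (G : SimpleGraph V) : ℕ :=
  sInf {g : ℕ | G.EmbedsInGenus g}

end SimpleGraph

/-! ### The binomial random bipartite graph -/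

/-- The law of the binomial random bipartite graph `G(n₁, n₂, p)`: every edge of the complete
bipartite graph with partition classes `Fin n₁` and `Fin n₂` is present independently with
probability `p`. -/
noncomputable def binomialRandomBipartite (n₁ n₂ : ℕ) (p : unitInterval) :
    Measure (SimpleGraph (Fin n₁ ⊕ Fin n₂)) :=
  (setBernoulli (completeBipartiteGraph (Fin n₁) (Fin n₂)).edgeSet p).map SimpleGraph.fromEdgeSet

/-! ### The constant `γ(d, λ)` -/

/-- The `k`-th term
`(d/√λ · e^{-d/√λ})^k ∑_{r+s=k} r^{s-1} s^{r-1} / (r! s!) · λ^r · e^{-d(λ-1)s/√λ}`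
of the series, with integer exponents and `0 ^ 0 = 1` (so that only the pairs `(1, 0)`, `(0, 1)` and
those with `r, s ≥ 1` contribute when `k ≥ 1`). -/
noncomputable def gammaTerm (d l : ℝ) (k : ℕ) : ℝ :=
  (d / √l * Real.exp (-(d / √l))) ^ k *
    ∑ x ∈ Finset.HasAntidiagonal.antidiagonal k,
      (x.1 : ℝ) ^ ((x.2 : ℤ) - 1) * (x.2 : ℝ) ^ ((x.1 : ℤ) - 1) /
          ((x.1.factorial : ℝ) * (x.2.factorial : ℝ)) *
        l ^ x.1 * Real.exp (-(d * (l - 1) / √l) * x.2)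

/-- `γ(d, λ) = 1/2 - (λ+1)/(2d√λ) + 1/(2d²) ∑_{k ≥ 1} gammaTerm d λ k`. -/
noncomputable def gammaConst (d l : ℝ) : ℝ :=
  1 / 2 - (l + 1) / (2 * d * √l) + 1 / (2 * d ^ 2) * ∑' k : ℕ, gammaTerm d l (k + 1)

/-! Write `β = e - v + κ` for the cyclomatic number. By Euler's formula a rotation system with `f`
faces has total genus `(β + κ - f) / 2`. Always `f ≥ κ`, so `2g ≤ β` up to rounding. Conversely, a
short face is either the only face of its component or runs along a short cycle. Hence `f - κ` is at
most the number of darts on short cycles plus `2e / L` for the faces longer than `L`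
(`RotationSystem.numFaces_le`). Sparse random graphs have few short cycles, so `2g = β + o(e)`, and
since `v` is fixed and `e` is easy, the question becomes one about the number of components.

Let `a` and `b` be the limits of `p n₁` and `p n₂`, so that `a b = d²`. After multiplication by `p`,
the expected number of components tends to the generating function `T(x, y)` of bipartite trees at
`x = a e^{-b}`, `y = b e^{-a}` (`SparseRegime.tendsto_card_connectedComponent`): components of
bounded size with a cycle are negligible, and large components are few. One edge changes `β` by at
most one, so the Efron–Stein inequality concentrates it.

The same limit evaluates `T`. If `a b < 1`, the expectation of `β` stays bounded, which forces `T(a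
e^{-b}, b e^{-a}) = a + b - a b` (`SparseRegime.treeSum_eq`). This identity determines the
coefficients of `T` and so proves Scoins' formula (`treeCoeff_eq`), which turns `T` into the series
defining `γ`. If `a b > 1`, the same point `(x, y)` also arises from a conjugate pair `a'`, `b'`
with `a' b' < 1`; the closed form at that pair gives `γ > 0` (`cyclomatic_density_pos`), as a
relative error bound requires. -/

namespace SimpleGraph

/-! ### Faces of rotation systems: genus against cyclomatic number. -/

variable {V : Type*} (G : SimpleGraph V)

/-- The dart `a` lies on a closed walk of length at most `L + 1` that uses its edge only once. -/
def IsShortCyclic (L : ℕ) (a : G.Dart) : Prop :=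
  ∃ w : G.Walk a.snd a.fst, w.length ≤ L ∧ a.edge ∉ w.edges

/-- The cyclomatic number `e - v + κ` of a graph. -/
noncomputable def cyclomatic : ℤ :=
  (Nat.card G.edgeSet : ℤ) - Nat.card V + Nat.card G.ConnectedComponent

theorem exists_rotationSystem [Finite V] : Nonempty G.RotationSystem := by
  classical
  have : Fintype V := Fintype.ofFinite V
  have h : ∀ v : V, ∃ f : Equiv.Perm {a : G.Dart // a.fst = v},
      ∀ a b, f.SameCycle a b := by
    intro v
    obtain ⟨f, hf, -⟩ :=
      (Finset.univ : Finset {a : G.Dart // a.fst = v}).exists_cycleOn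
    exact ⟨f, fun a b => hf.2 (by simp) (by simp)⟩
  choose f hf using h
  let e := Equiv.sigmaFiberEquiv (fun a : G.Dart => a.fst)
  let g : Equiv.Perm G.Dart := (e.symm.trans (Equiv.sigmaCongrRight f)).trans e
  have hg : ∀ (v : V) (x : {a : G.Dart // a.fst = v}), g x.1 = (f v x).1 := by
    rintro v ⟨x, rfl⟩
    rfl
  have hgn : ∀ (v : V) (n : ℕ) (x : {a : G.Dart // a.fst = v}),
      (g ^ n) x.1 = ((f v ^ n) x).1 := by
    intro v n
    induction n with
    | zero => simp
    | succ n ih => intro x; rw [pow_succ, pow_succ, Equiv.Perm.mul_apply, hg, ih]; rfl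
  refine ⟨⟨g, fun a => ?_, fun a b hab => ?_⟩⟩
  · rw [hg a.fst ⟨a, rfl⟩]
    exact (f a.fst ⟨a, rfl⟩).2
  · obtain ⟨n, hn⟩ := (hf b.fst ⟨a, hab⟩ ⟨b, rfl⟩).exists_nat_pow_eq
    refine ⟨n, ?_⟩
    rw [zpow_natCast, hgn b.fst n ⟨a, hab⟩, hn]

namespace RotationSystem

variable {G} (R : G.RotationSystem)

theorem facePerm_apply (a : G.Dart) : R.facePerm a = R.next a.symm := rfl

theorem fst_facePerm (a : G.Dart) : (R.facePerm a).fst = a.snd := by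
  rw [facePerm_apply, R.fst_next]; rfl

/-- A face never leaves its component, and a component without darts is an isolated vertex, so faces
map onto components. This is the inequality `f ≥ κ` behind the upper bound for the genus. -/
theorem card_connectedComponent_le_numFaces [Finite V] :
    Nat.card G.ConnectedComponent ≤ R.numFaces := by
  classical
  have : Fintype V := Fintype.ofFinite V
  unfold numFaces
  rw [← Nat.card_sum]
  have hcomp : ∀ a b : G.Dart, R.facePerm.SameCycle a b →
      G.connectedComponentMk a.fst = G.connectedComponentMk b.fst := by
    have hstep : ∀ (n : ℕ) (a : G.Dart), G.connectedComponentMk a.fst =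
        G.connectedComponentMk ((R.facePerm ^ n) a).fst := by
      intro n
      induction n with
      | zero => simp
      | succ n ih =>
        intro a
        rw [pow_succ, Equiv.Perm.mul_apply, ← ih, fst_facePerm]
        exact ConnectedComponent.sound a.adj.reachable
    intro a b hab
    obtain ⟨n, rfl⟩ := hab.exists_nat_pow_eq
    exact hstep n a
  let F : Quotient (Equiv.Perm.SameCycle.setoid R.facePerm) ⊕ {v : V // ∀ w, ¬ G.Adj v w} →
      G.ConnectedComponent := Sum.elim
    (Quotient.lift (fun a => G.connectedComponentMk a.fst) hcomp)
    (fun v => G.connectedComponentMk v.1)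
  refine Nat.card_le_card_of_surjective F ?_
  intro c
  induction c using ConnectedComponent.ind with
  | h v =>
    by_cases hv : ∀ w, ¬ G.Adj v w
    · exact ⟨Sum.inr ⟨v, hv⟩, rfl⟩
    · push Not at hv
      obtain ⟨w, hw⟩ := hv
      exact ⟨Sum.inl (Quotient.mk _ ⟨(v, w), hw⟩), rfl⟩

/-- A walk along the face of `a`, from the end of `a` to the start of the `n + 1`-st dart. -/
theorem exists_walk_along_face (a : G.Dart) (n : ℕ) (h : ∀ i, 0 < i → i ≤ n →
      (R.facePerm ^ i) a ≠ a ∧ (R.facePerm ^ i) a ≠ a.symm) :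
    ∃ w : G.Walk a.snd ((R.facePerm ^ (n + 1)) a).fst, w.length = n ∧ a.edge ∉ w.edges := by
  induction n with
  | zero =>
    refine ⟨Walk.nil.copy rfl (by simp [fst_facePerm]), by simp, by simp⟩
  | succ n ih =>
    obtain ⟨w, hw, hwe⟩ := ih (fun i hi hin => h i hi (by omega))
    have hd : ((R.facePerm ^ (n + 1 + 1)) a).fst = ((R.facePerm ^ (n + 1)) a).snd := by
      rw [pow_succ', Equiv.Perm.mul_apply, fst_facePerm]
    refine ⟨(w.concat ((R.facePerm ^ (n + 1)) a).adj).copy rfl hd.symm, by simp [hw], ?_⟩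
    rw [Walk.edges_copy, Walk.edges_concat, List.concat_eq_append, List.mem_append, not_or]
    refine ⟨hwe, ?_⟩
    rw [List.mem_singleton]
    intro he
    rcases (dart_edge_eq_iff _ _).1 (show ((R.facePerm ^ (n + 1)) a).edge = a.edge from he.symm)
      with h' | h'
    · exact (h (n + 1) (by omega) le_rfl).1 h'
    · exact (h (n + 1) (by omega) le_rfl).2 h'

/-- A dart on a face with at most `L` darts whose reverse is not on the face is short cyclic. -/
theorem isShortCyclic_of_symm_not_sameCycle [Finite V] {L : ℕ} (a : G.Dart)
    (hL : Nat.card {b // R.facePerm.SameCycle a b} ≤ L)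
    (ha : ¬ R.facePerm.SameCycle a a.symm) : G.IsShortCyclic L a := by
  classical
  have : Fintype V := Fintype.ofFinite V
  have hex : ∃ n, 0 < n ∧ (R.facePerm ^ n) a = a :=
    ⟨orderOf R.facePerm, orderOf_pos _, by simp [pow_orderOf_eq_one]⟩
  set m := Nat.find hex with hm
  obtain ⟨hm0, hma⟩ := Nat.find_spec hex
  have hmin : ∀ i, 0 < i → i < m → (R.facePerm ^ i) a ≠ a := fun i hi him h =>
    Nat.find_min hex him ⟨hi, h⟩
  have hmL : m ≤ L := by
    refine le_trans ?_ hL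
    have hinj : Function.Injective (fun i : Fin m =>
        (⟨(R.facePerm ^ (i : ℕ)) a, ⟨(i : ℕ), by simp⟩⟩ :
          {b // R.facePerm.SameCycle a b})) := by
      have key : ∀ i j : ℕ, i < j → j < m →
          (R.facePerm ^ i) a ≠ (R.facePerm ^ j) a := by
        intro i j hij hj h
        have : (R.facePerm ^ (j - i)) a = a := by
          apply (R.facePerm ^ i).injective
          rw [← Equiv.Perm.mul_apply, ← pow_add, Nat.add_sub_cancel' hij.le, h]
        exact hmin (j - i) (by omega) (by omega) this
      intro i j hij
      have hij' := congrArg Subtype.val hij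
      rcases lt_trichotomy i j with h | h | h
      · exact absurd hij' (key i j h j.2)
      · exact h
      · exact absurd hij'.symm (key j i h i.2)
    simpa using Nat.card_le_card_of_injective _ hinj
  -- The rest of the face leads from the end of `a` back to its start. It avoids the edge of `a`,
  -- because `a` recurs only at the first return time `m` and its reverse never occurs.
  obtain ⟨w, hw, hwe⟩ := R.exists_walk_along_face a (m - 1) (fun i hi hin =>
    ⟨hmin i hi (by omega), fun h => ha ⟨i, by simpa using h⟩⟩)
  have hend : ((R.facePerm ^ (m - 1 + 1)) a).fst = a.fst := by
    rw [Nat.sub_add_cancel hm0]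
    exact congrArg (fun d : G.Dart => d.fst) hma
  exact ⟨w.copy rfl hend, by simp; omega, by simpa using hwe⟩

/-- If the reverse of every dart of the face of `a` is on the face, then this face contains all
darts of the connected component of `a`. -/
theorem sameCycle_of_reachable [Finite V] (a : G.Dart)
    (ha : ∀ b, R.facePerm.SameCycle a b → R.facePerm.SameCycle a b.symm)
    (b : G.Dart) (hb : G.Reachable a.fst b.fst) : R.facePerm.SameCycle a b := by
  classical
  have : Fintype V := Fintype.ofFinite V
  -- Applying the face permutation to a reversed dart gives its rotation successor. So closure under
  -- reversal yields closure under rotation: the face fills every vertex it meets, and then spreads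
  -- along walks.
  have hnext : ∀ b, R.facePerm.SameCycle a b → R.facePerm.SameCycle a (R.next b) := by
    intro b hb
    have h := (Equiv.Perm.sameCycle_apply_right (f := R.facePerm)).2 (ha b hb)
    rwa [facePerm_apply, Dart.symm_symm] at h
  have hnextn : ∀ (n : ℕ) b, R.facePerm.SameCycle a b →
      R.facePerm.SameCycle a ((R.next ^ n) b) := by
    intro n
    induction n with
    | zero => simp
    | succ n ih => intro b hb; rw [pow_succ, Equiv.Perm.mul_apply]; exact ih _ (hnext b hb)
  have hvert : ∀ b c : G.Dart, R.facePerm.SameCycle a b → b.fst = c.fst →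
      R.facePerm.SameCycle a c := by
    intro b c hb hbc
    obtain ⟨n, rfl⟩ := (R.sameCycle b c hbc).exists_nat_pow_eq
    exact hnextn n b hb
  obtain ⟨w⟩ := hb
  have key : ∀ (u v : V) (w : G.Walk u v) (x : G.Dart), R.facePerm.SameCycle a x → x.fst = u →
      ∀ c : G.Dart, c.fst = v → R.facePerm.SameCycle a c := by
    intro u v w
    induction w with
    | nil => intro x hx hxu c hc; exact hvert x c hx (hxu.trans hc.symm)
    | cons h p ih =>
      rename_i u y v
      intro x hx hxu c hc
      have h1 := hvert x ⟨(u, y), h⟩ hx hxu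
      exact ih _ (ha _ h1) rfl c hc
  exact key _ _ w a (Equiv.Perm.SameCycle.refl _ _) rfl b rfl

/-- Faces fall into three kinds. Those containing a short cyclic dart (`Q1`) are at most as many as
such darts. Those with more than `L` darts (`Q2`) number at most `2e / L`, since faces partition the
`2e` darts. Any other face (`Q3`) is closed under reversal, hence is the whole of its component;
together with the isolated vertices these inject into the components. -/
theorem numFaces_le [Finite V] (L : ℕ) (hL : 0 < L) :
    (R.numFaces : ℝ) ≤ Nat.card G.ConnectedComponent + Nat.card {a // G.IsShortCyclic L a} +
      2 * Nat.card G.edgeSet / L := by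
  classical
  have : Fintype V := Fintype.ofFinite V
  let s := Equiv.Perm.SameCycle.setoid R.facePerm
  let Q1 : Set (Quotient s) := {q | ∃ a, Quotient.mk s a = q ∧ G.IsShortCyclic L a}
  let Q2 : Set (Quotient s) := {q | L < Nat.card {b // Quotient.mk s b = q}}
  let Q3 : Set (Quotient s) := (Q1 ∪ Q2)ᶜ
  have hmk : ∀ a b : G.Dart, Quotient.mk s a = Quotient.mk s b ↔ R.facePerm.SameCycle a b :=
    fun a b => Quotient.eq (r := s)
  have h1 : Nat.card Q1 ≤ Nat.card {a // G.IsShortCyclic L a} := by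
    refine Nat.card_le_card_of_surjective
      (fun a : {a // G.IsShortCyclic L a} => (⟨Quotient.mk s a.1, a.1, rfl, a.2⟩ : Q1)) ?_
    rintro ⟨q, a, rfl, ha⟩
    exact ⟨⟨a, ha⟩, rfl⟩
  have hdart : Fintype.card G.Dart = 2 * Nat.card G.edgeSet := by
    rw [G.dart_card_eq_twice_card_edges, Nat.card_eq_fintype_card, edgeFinset_card]
  have h2 : L * Nat.card Q2 ≤ 2 * Nat.card G.edgeSet := by
    rw [← hdart]
    have hsum : Fintype.card G.Dart =
        ∑ q : Quotient s, Nat.card {b // Quotient.mk s b = q} := by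
      rw [← Nat.card_eq_fintype_card, ← Nat.card_sigma]
      exact Nat.card_congr (Equiv.sigmaFiberEquiv (Quotient.mk s)).symm
    rw [hsum, Nat.card_eq_fintype_card, Fintype.card_subtype, mul_comm, ← smul_eq_mul]
    refine le_trans (Finset.card_nsmul_le_sum _ (fun q => Nat.card {b // Quotient.mk s b = q}) L
      ?_) (Finset.sum_le_sum_of_subset (Finset.subset_univ _))
    intro q hq
    exact (Finset.mem_filter.1 hq).2.le
  have h3 : Nat.card Q3 + Nat.card {v : V // ∀ w, ¬ G.Adj v w} ≤
      Nat.card G.ConnectedComponent := by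
    rw [← Nat.card_sum]
    refine Nat.card_le_card_of_injective
      (Sum.elim (fun q : Q3 => G.connectedComponentMk q.1.out.fst)
        (fun v : {v : V // ∀ w, ¬ G.Adj v w} => G.connectedComponentMk v.1)) ?_
    have hiso : ∀ (v : V), (∀ w, ¬ G.Adj v w) → ∀ u, G.Reachable v u → u = v := by
      intro v hv u hvu
      obtain ⟨w⟩ := hvu
      cases w with
      | nil => rfl
      | cons h p => exact absurd h (hv _)
    have hQ : ∀ q : Quotient s, q ∈ Q3 → ∀ b : G.Dart, G.Reachable q.out.fst b.fst →
        Quotient.mk s b = q := by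
      intro q hq b hb
      have hq' : q ∉ Q1 ∧ q ∉ Q2 := by
        simpa only [Q3, Set.mem_compl_iff, Set.mem_union, not_or] using hq
      have hqo : Quotient.mk s q.out = q := Quotient.out_eq q
      refine Eq.trans ?_ hqo
      rw [eq_comm, hmk]
      refine R.sameCycle_of_reachable _ ?_ b hb
      intro c hc
      by_contra hcs
      refine hq'.1 ⟨c, ?_, R.isShortCyclic_of_symm_not_sameCycle c ?_ ?_⟩
      · rw [← hqo, eq_comm, hmk]; exact hc
      · have hn : Nat.card {b // Quotient.mk s b = q} ≤ L := not_lt.1 hq'.2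
        refine le_of_eq_of_le (Nat.card_congr (Equiv.subtypeEquivRight fun b => ?_)) hn
        rw [← hqo, hmk]
        exact ⟨fun h => (hc.trans h).symm, fun h => (h.trans hc).symm⟩
      · exact fun h => hcs (hc.trans h)
    rintro (⟨q, hq⟩ | ⟨v, hv⟩) (⟨q', hq'⟩ | ⟨v', hv'⟩) h
    · have h' := hQ q hq q'.out (ConnectedComponent.exact h)
      rw [Quotient.out_eq] at h'
      simp [h']
    · have h' := hiso v' hv' _ (ConnectedComponent.exact h).symm
      exact absurd (h' ▸ q.out.adj) (hv' _)
    · have h' := hiso v hv _ (ConnectedComponent.exact h)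
      exact absurd (h' ▸ q'.out.adj) (hv _)
    · have h' := hiso v hv _ (ConnectedComponent.exact h)
      simp only [Sum.inr.injEq, Subtype.mk.injEq]
      exact h'.symm
  have hQcard : Nat.card (Quotient s) ≤ Nat.card Q1 + Nat.card Q2 + Nat.card Q3 := by
    have e1 : Nat.card (Quotient s) = Nat.card ((Q1 ∪ Q2 : Set _)) + Nat.card Q3 := by
      rw [Nat.card_coe_set_eq, Nat.card_coe_set_eq, Set.ncard_add_ncard_compl]
    have e2 : Nat.card ((Q1 ∪ Q2 : Set _)) ≤ Nat.card Q1 + Nat.card Q2 := by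
      simp only [Nat.card_coe_set_eq]
      exact Set.ncard_union_le _ _
    omega
  have h2' : (Nat.card Q2 : ℝ) ≤ 2 * Nat.card G.edgeSet / L := by
    rw [le_div_iff₀ (by exact_mod_cast hL), mul_comm]
    exact_mod_cast h2
  have hfin : (R.numFaces : ℝ) ≤ Nat.card G.ConnectedComponent +
      Nat.card {a // G.IsShortCyclic L a} + Nat.card Q2 := by
    have : R.numFaces ≤ Nat.card G.ConnectedComponent +
      Nat.card {a // G.IsShortCyclic L a} + Nat.card Q2 := by
      unfold numFaces
      change Nat.card (Quotient s) + _ ≤ _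
      omega
    exact_mod_cast this
  linarith

end RotationSystem

theorem embedsInGenus_genus [Finite V] : G.EmbedsInGenus G.genus := by
  obtain ⟨R⟩ := G.exists_rotationSystem
  refine Nat.sInf_mem (s := {g : ℕ | G.EmbedsInGenus g})
    ⟨(2 * (Nat.card G.ConnectedComponent : ℤ) - R.eulerChar).toNat, R, ?_⟩
  have := Int.self_le_toNat (2 * (Nat.card G.ConnectedComponent : ℤ) - R.eulerChar)
  linarith [Int.natCast_nonneg (2 * (Nat.card G.ConnectedComponent : ℤ) - R.eulerChar).toNat]

theorem two_mul_genus_le [Finite V] (h0 : 0 ≤ G.cyclomatic) :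
    (2 * G.genus : ℝ) ≤ G.cyclomatic + 1 := by
  obtain ⟨R⟩ := G.exists_rotationSystem
  have hR := R.card_connectedComponent_le_numFaces
  -- Rounding up avoids the parity of `β + κ - f`; the extra one disappears after multiplication by
  -- `p`.
  have h : G.genus ≤ ((G.cyclomatic + 1) / 2).toNat := by
    refine Nat.sInf_le ⟨R, ?_⟩
    rw [Int.toNat_of_nonneg (by omega)]
    unfold RotationSystem.eulerChar
    unfold cyclomatic at h0 ⊢
    omega
  have h' : 2 * (G.genus : ℤ) ≤ G.cyclomatic + 1 := by omega
  exact_mod_cast h'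

theorem le_two_mul_genus [Finite V] (L : ℕ) (hL : 0 < L) :
    (G.cyclomatic : ℝ) - Nat.card {a // G.IsShortCyclic L a} - 2 * Nat.card G.edgeSet / L ≤
      2 * G.genus := by
  obtain ⟨R, hR⟩ := G.embedsInGenus_genus
  have h := R.numFaces_le L hL
  unfold RotationSystem.eulerChar at hR
  have hR' : 2 * (Nat.card G.ConnectedComponent : ℝ) -
      (Nat.card V - Nat.card G.edgeSet + R.numFaces) ≤ 2 * G.genus := by exact_mod_cast hR
  unfold cyclomatic
  push_cast
  linarith

end SimpleGraph

/-! ### Bipartite graphs as sets of pairs, and the effect of adding one edge. -/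

namespace SimpleGraph

section AddEdge

variable {V : Type*} (G : SimpleGraph V) {u v : V}

theorem reachable_of_reachable_sup_edge {x y : V} (h : (G ⊔ edge u v).Reachable x y) :
    G.Reachable x y ∨ (G.Reachable x u ∧ G.Reachable v y) ∨
      (G.Reachable x v ∧ G.Reachable u y) := by
  obtain ⟨w⟩ := h
  induction w with
  | nil => exact Or.inl (Reachable.refl _)
  | @cons a b c h p ih =>
    rw [sup_adj, edge_adj] at h
    rcases h with h | ⟨⟨rfl, rfl⟩ | ⟨rfl, rfl⟩, -⟩
    · rcases ih with ih | ⟨h1, h2⟩ | ⟨h1, h2⟩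
      · exact Or.inl (h.reachable.trans ih)
      · exact Or.inr (Or.inl ⟨h.reachable.trans h1, h2⟩)
      · exact Or.inr (Or.inr ⟨h.reachable.trans h1, h2⟩)
    · rcases ih with ih | ⟨h1, h2⟩ | ⟨h1, h2⟩
      · exact Or.inr (Or.inl ⟨Reachable.refl _, ih⟩)
      · exact Or.inr (Or.inl ⟨Reachable.refl _, h2⟩)
      · exact Or.inl h2
    · rcases ih with ih | ⟨h1, h2⟩ | ⟨h1, h2⟩
      · exact Or.inr (Or.inr ⟨Reachable.refl _, ih⟩)
      · exact Or.inl h2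
      · exact Or.inr (Or.inr ⟨Reachable.refl _, h2⟩)

theorem card_connectedComponent_sup_edge_le [Finite V] :
    Nat.card (G ⊔ edge u v).ConnectedComponent ≤ Nat.card G.ConnectedComponent :=
  Nat.card_le_card_of_surjective _
    (ConnectedComponent.surjective_map_ofLE (le_sup_left : G ≤ G ⊔ edge u v))

/-- Only the component of `v` can be absorbed by another one: sending it to `none`, the remaining
components stay distinct in the larger graph. -/
theorem card_connectedComponent_le_sup_edge_add_one [Finite V] :
    Nat.card G.ConnectedComponent ≤ Nat.card (G ⊔ edge u v).ConnectedComponent + 1 := by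
  classical
  rw [← Finite.card_option]
  refine Nat.card_le_card_of_injective (fun c => if c = G.connectedComponentMk v then none else
    some (c.map (Hom.ofLE (le_sup_left : G ≤ G ⊔ edge u v)))) ?_
  intro c c' h
  induction c using ConnectedComponent.ind with | h x =>
  induction c' using ConnectedComponent.ind with | h y =>
  by_cases hx : G.connectedComponentMk x = G.connectedComponentMk v
  · by_cases hy : G.connectedComponentMk y = G.connectedComponentMk v
    · rw [hx, hy]
    · simp [hx, hy] at h
  · by_cases hy : G.connectedComponentMk y = G.connectedComponentMk v
    · simp [hx, hy] at h
    · simp only [hx, hy, if_false, Option.some.injEq] at h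
      have h' : (G ⊔ edge u v).Reachable x y := ConnectedComponent.exact h
      rcases G.reachable_of_reachable_sup_edge h' with h | ⟨-, h⟩ | ⟨h, -⟩
      · exact ConnectedComponent.sound h
      · exact absurd (ConnectedComponent.sound h.symm) hy
      · exact absurd (ConnectedComponent.sound h) hx

theorem card_connectedComponent_sup_edge_lt [Finite V] (huv : ¬ G.Reachable u v) :
    Nat.card (G ⊔ edge u v).ConnectedComponent < Nat.card G.ConnectedComponent := by
  classical
  have : Fintype V := Fintype.ofFinite V
  have : Fintype G.ConnectedComponent := Fintype.ofFinite _
  have : Fintype (G ⊔ edge u v).ConnectedComponent := Fintype.ofFinite _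
  rw [Nat.card_eq_fintype_card, Nat.card_eq_fintype_card]
  refine Fintype.card_lt_of_surjective_not_injective _
    (ConnectedComponent.surjective_map_ofLE (le_sup_left : G ≤ G ⊔ edge u v)) fun hinj => ?_
  have hne : u ≠ v := fun h => huv (h ▸ Reachable.refl _)
  refine huv (ConnectedComponent.exact (hinj (ConnectedComponent.sound (Adj.reachable ?_))))
  change (G ⊔ edge u v).Adj u v
  rw [sup_adj, edge_adj]
  exact Or.inr ⟨Or.inl ⟨rfl, rfl⟩, hne⟩

end AddEdge

/-- The bipartite graph with edge set `S`. -/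
def bip {α β : Type*} (S : Finset (α × β)) : SimpleGraph (α ⊕ β) where
  Adj u v := ∃ e ∈ S, (u = Sum.inl e.1 ∧ v = Sum.inr e.2) ∨ (v = Sum.inl e.1 ∧ u = Sum.inr e.2)
  symm := ⟨fun _ _ ⟨e, he, h⟩ => ⟨e, he, h.symm⟩⟩
  loopless := ⟨fun u ⟨e, _, h⟩ => by
    rcases h with ⟨h1, h2⟩ | ⟨h1, h2⟩ <;> simp [h1] at h2⟩

section Bip

variable {α β : Type*}

/-- The edge of the complete bipartite graph given by a pair. -/
def bipEdge : α × β ↪ Sym2 (α ⊕ β) where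
  toFun e := s(Sum.inl e.1, Sum.inr e.2)
  inj' := by
    rintro ⟨a, b⟩ ⟨c, d⟩ h
    simpa using h

theorem bipEdge_apply (e : α × β) : bipEdge e = s(Sum.inl e.1, Sum.inr e.2) := rfl

@[simp] theorem bip_adj_inl_inr {S : Finset (α × β)} {x : α} {y : β} :
    (bip S).Adj (Sum.inl x) (Sum.inr y) ↔ (x, y) ∈ S := by
  simp [bip]

@[simp] theorem bip_adj_inr_inl {S : Finset (α × β)} {x : α} {y : β} :
    (bip S).Adj (Sum.inr y) (Sum.inl x) ↔ (x, y) ∈ S := by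
  simp [bip]

@[simp] theorem not_bip_adj_inl_inl {S : Finset (α × β)} {x x' : α} :
    ¬ (bip S).Adj (Sum.inl x) (Sum.inl x') := by
  simp [bip]

@[simp] theorem not_bip_adj_inr_inr {S : Finset (α × β)} {y y' : β} :
    ¬ (bip S).Adj (Sum.inr y) (Sum.inr y') := by
  simp [bip]

theorem bip_mono {S T : Finset (α × β)} (h : S ⊆ T) : bip S ≤ bip T := by
  rintro u v ⟨e, he, huv⟩
  exact ⟨e, h he, huv⟩

theorem edgeSet_bip (S : Finset (α × β)) : (bip S).edgeSet = bipEdge '' (S : Set (α × β)) := by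
  ext e
  induction e with
  | h u v =>
    rcases u with x | y <;> rcases v with x' | y' <;>
      simp [bipEdge_apply]

theorem card_edgeSet_bip (S : Finset (α × β)) : Nat.card (bip S).edgeSet = S.card := by
  rw [edgeSet_bip, Nat.card_coe_set_eq, Set.ncard_image_of_injective _ bipEdge.injective,
    Set.ncard_coe_finset]

theorem fromEdgeSet_bipEdge (S : Finset (α × β)) :
    fromEdgeSet (bipEdge '' (S : Set (α × β))) = bip S := by
  rw [← edgeSet_bip, fromEdgeSet_edgeSet]

theorem bip_insert [DecidableEq α] [DecidableEq β] (e : α × β) (S : Finset (α × β)) :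
    bip (insert e S) = bip S ⊔ edge (Sum.inl e.1) (Sum.inr e.2) := by
  obtain ⟨a, b⟩ := e
  ext u v
  rcases u with x | y <;> rcases v with x' | y' <;>
    simp [edge_adj, or_comm]
  all_goals tauto

open Classical in
/-- The edges whose endpoints are joined by another path of length at most `L`. -/
noncomputable def shortEdges (S : Finset (α × β)) (L : ℕ) : Finset (α × β) :=
  S.filter fun e => ∃ w : (bip S).Walk (Sum.inl e.1) (Sum.inr e.2),
    w.IsPath ∧ w.length ≤ L ∧ bipEdge e ∉ w.edges

theorem exists_isPath_bip {S : Finset (α × β)} {L : ℕ} {u v : α ⊕ β} {e : Sym2 (α ⊕ β)}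
    (w : (bip S).Walk u v) (hw : w.length ≤ L) (he : e ∉ w.edges) :
    ∃ w : (bip S).Walk u v, w.IsPath ∧ w.length ≤ L ∧ e ∉ w.edges := by
  classical
  exact ⟨w.bypass, w.bypass_isPath, w.length_bypass_le_length.trans hw,
    fun h => he (w.edges_bypass_subset_edges h)⟩

theorem card_isShortCyclic_le (S : Finset (α × β)) (L : ℕ) :
    Nat.card {a // (bip S).IsShortCyclic L a} ≤ 2 * (shortEdges S L).card := by
  classical
  have hrev : ∀ {u v : α ⊕ β} {e : Sym2 (α ⊕ β)} (w : (bip S).Walk u v), w.length ≤ L →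
      e ∉ w.edges → ∃ w : (bip S).Walk v u, w.length ≤ L ∧ e ∉ w.edges := by
    intro u v e w hw he
    exact ⟨w.reverse, by simpa using hw, by simpa using he⟩
  have key : ∀ a : {a // (bip S).IsShortCyclic L a}, ∃ e : shortEdges S L,
      a.1.toProd = (Sum.inl e.1.1, Sum.inr e.1.2) ∨ a.1.toProd = (Sum.inr e.1.2, Sum.inl e.1.1) := by
    rintro ⟨⟨⟨u, v⟩, h⟩, w, hw, hwe⟩
    rcases u with x | y <;> rcases v with x' | y'
    · simp at h
    · obtain ⟨w', hw', he'⟩ := hrev w hw hwe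
      refine ⟨⟨(x, y'), Finset.mem_filter.2 ⟨by simpa using h, exists_isPath_bip w' hw' he'⟩⟩,
        Or.inl rfl⟩
    · have he' : bipEdge (x', y) ∉ w.edges := by
        rw [bipEdge_apply, Sym2.eq_swap]; exact hwe
      exact ⟨⟨(x', y), Finset.mem_filter.2 ⟨by simpa using h, exists_isPath_bip w hw he'⟩⟩,
        Or.inr rfl⟩
    · simp at h
  choose f hf using key
  have hb : Nat.card (Bool × shortEdges S L) = 2 * (shortEdges S L).card := by simp
  rw [← hb]
  refine Nat.card_le_card_of_injective (fun a => (a.1.fst.isLeft, f a)) ?_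
  intro a a' h
  simp only [Prod.mk.injEq] at h
  obtain ⟨h1, h2⟩ := h
  apply Subtype.ext
  apply Dart.ext
  have ha := hf a
  have ha' := hf a'
  rw [← h2] at ha'
  rcases ha with ha | ha <;> rcases ha' with ha' | ha' <;> rw [ha, ha'] <;>
    rw [ha, ha'] at h1 <;> simp at h1

theorem shortEdges_mono {S T : Finset (α × β)} (h : S ⊆ T) (L : ℕ) :
    shortEdges S L ⊆ shortEdges T L := by
  classical
  intro e he
  obtain ⟨heS, w, hw, hwL, hwe⟩ := Finset.mem_filter.1 he
  exact Finset.mem_filter.2 ⟨h heS, w.mapLe (bip_mono h), hw.mapLe _, by simpa using hwL,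
    by simpa using hwe⟩

variable [Fintype α] [Fintype β]

theorem cyclomatic_bip_empty : (bip (∅ : Finset (α × β))).cyclomatic = 0 := by
  have h : Nat.card (bip (∅ : Finset (α × β))).ConnectedComponent = Nat.card (α ⊕ β) := by
    refine (Nat.card_congr (Equiv.ofBijective (bip ∅).connectedComponentMk ⟨?_, ?_⟩)).symm
    · intro u v h
      obtain ⟨w⟩ := ConnectedComponent.exact h
      cases w with
      | nil => rfl
      | cons h p => obtain ⟨e, he, -⟩ := h; simp at he
    · exact Quot.mk_surjective
  rw [cyclomatic, card_edgeSet_bip, h]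
  simp

section Insert

variable [DecidableEq α] [DecidableEq β] {S : Finset (α × β)} {e : α × β}

/-- A new edge raises `e` by one and lowers `κ` by zero or one. With `cyclomatic_bip_insert_le` this
is the Lipschitz condition for the Efron–Stein inequality. -/
theorem cyclomatic_bip_le_insert (he : e ∉ S) :
    (bip S).cyclomatic ≤ (bip (insert e S)).cyclomatic := by
  have h := (bip S).card_connectedComponent_le_sup_edge_add_one
    (u := Sum.inl e.1) (v := Sum.inr e.2)
  rw [← bip_insert] at h
  simp only [cyclomatic, card_edgeSet_bip, Finset.card_insert_of_notMem he]
  omega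

theorem cyclomatic_bip_insert_le (he : e ∉ S) :
    (bip (insert e S)).cyclomatic ≤ (bip S).cyclomatic + 1 := by
  have h := (bip S).card_connectedComponent_sup_edge_le
    (u := Sum.inl e.1) (v := Sum.inr e.2)
  rw [← bip_insert] at h
  simp only [cyclomatic, card_edgeSet_bip, Finset.card_insert_of_notMem he]
  omega

theorem cyclomatic_bip_insert_le_of_not_reachable (he : e ∉ S)
    (h : ¬ (bip S).Reachable (Sum.inl e.1) (Sum.inr e.2)) :
    (bip (insert e S)).cyclomatic ≤ (bip S).cyclomatic := by
  have h := (bip S).card_connectedComponent_sup_edge_lt h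
  rw [← bip_insert] at h
  simp only [cyclomatic, card_edgeSet_bip, Finset.card_insert_of_notMem he]
  omega

end Insert

theorem cyclomatic_bip_nonneg (S : Finset (α × β)) : 0 ≤ (bip S).cyclomatic := by
  classical
  induction S using Finset.induction_on with
  | empty => rw [cyclomatic_bip_empty]
  | insert e S he ih => exact ih.trans (cyclomatic_bip_le_insert he)

/-- Insert the edges one at a time. The cyclomatic number grows only when the endpoints were already
connected; then the new edge closes a cycle and joins `shortEdges`, while earlier members remain.
The length cap is the number of vertices, so it excludes no path. -/
theorem cyclomatic_bip_le (S : Finset (α × β)) :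
    (bip S).cyclomatic ≤ (shortEdges S (Fintype.card (α ⊕ β))).card := by
  classical
  induction S using Finset.induction_on with
  | empty => rw [cyclomatic_bip_empty]; positivity
  | insert e S he ih =>
    have hsub := shortEdges_mono (Finset.subset_insert e S) (Fintype.card (α ⊕ β))
    by_cases hr : (bip S).Reachable (Sum.inl e.1) (Sum.inr e.2)
    · have hmem : e ∈ shortEdges (insert e S) (Fintype.card (α ⊕ β)) := by
        obtain ⟨w, hw⟩ := hr.exists_isPath
        refine Finset.mem_filter.2 ⟨by simp, w.mapLe (bip_mono (Finset.subset_insert e S)),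
          hw.mapLe _, by simpa using hw.length_lt.le, ?_⟩
        rw [Walk.edges_mapLe_eq_edges]
        intro h
        have := w.edges_subset_edgeSet h
        rw [edgeSet_bip] at this
        simp [he] at this
      have hne : e ∉ shortEdges S (Fintype.card (α ⊕ β)) := fun h =>
        he (Finset.mem_filter.1 h).1
      have hc := Finset.card_le_card (Finset.insert_subset hmem hsub)
      rw [Finset.card_insert_of_notMem hne] at hc
      have := cyclomatic_bip_insert_le he
      omega
    · have := cyclomatic_bip_insert_le_of_not_reachable he hr
      have := Finset.card_le_card hsub
      omega

end Bip

end SimpleGraph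

/-! ### Random subsets: expectation, Efron–Stein, and the law of the random graph. -/

section Bernoulli

variable {ι : Type*}

/-- The expectation of `f S` for a random subset `S` of `E` which contains each element
independently with probability `p`. -/
noncomputable def bernoulliExp (p : ℝ) (E : Finset ι) (f : Finset ι → ℝ) : ℝ :=
  ∑ S ∈ E.powerset, p ^ S.card * (1 - p) ^ (E.card - S.card) * f S

variable {p : ℝ} {E : Finset ι} {f g : Finset ι → ℝ}

theorem bernoulliExp_const (c : ℝ) : bernoulliExp p E (fun _ => c) = c := by
  unfold bernoulliExp
  rw [← Finset.sum_mul, Finset.sum_pow_mul_eq_add_pow]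
  simp

theorem bernoulliExp_add : bernoulliExp p E (fun S => f S + g S) =
    bernoulliExp p E f + bernoulliExp p E g := by
  simp [bernoulliExp, mul_add, Finset.sum_add_distrib]

theorem bernoulliExp_const_mul (c : ℝ) : bernoulliExp p E (fun S => c * f S) =
    c * bernoulliExp p E f := by
  simp only [bernoulliExp, Finset.mul_sum]
  exact Finset.sum_congr rfl fun S _ => by ring

theorem bernoulliExp_sub : bernoulliExp p E (fun S => f S - g S) =
    bernoulliExp p E f - bernoulliExp p E g := by
  simp [bernoulliExp, mul_sub, Finset.sum_sub_distrib]

theorem bernoulliExp_sum {κ : Type*} (s : Finset κ) (f : κ → Finset ι → ℝ) :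
    bernoulliExp p E (fun S => ∑ k ∈ s, f k S) = ∑ k ∈ s, bernoulliExp p E (f k) := by
  simp only [bernoulliExp, Finset.mul_sum]
  exact Finset.sum_comm

theorem bernoulliExp_mono (hp0 : 0 ≤ p) (hp1 : p ≤ 1) (h : ∀ S ⊆ E, f S ≤ g S) :
    bernoulliExp p E f ≤ bernoulliExp p E g := by
  refine Finset.sum_le_sum fun S hS => ?_
  have := sub_nonneg.2 hp1
  exact mul_le_mul_of_nonneg_left (h S (Finset.mem_powerset.1 hS)) (by positivity)

theorem bernoulliExp_congr (h : ∀ S ⊆ E, f S = g S) :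
    bernoulliExp p E f = bernoulliExp p E g :=
  Finset.sum_congr rfl fun S hS => by rw [h S (Finset.mem_powerset.1 hS)]

theorem bernoulliExp_markov (hp0 : 0 ≤ p) (hp1 : p ≤ 1) (hf : ∀ S ⊆ E, 0 ≤ f S) {c : ℝ}
    (hc : 0 < c) (P : Finset ι → Prop) [DecidablePred P] (hP : ∀ S ⊆ E, ¬ P S → c ≤ f S) :
    1 - bernoulliExp p E f / c ≤ bernoulliExp p E (fun S => if P S then 1 else 0) := by
  have h : bernoulliExp p E (fun S => 1 - c⁻¹ * f S) ≤
      bernoulliExp p E (fun S => if P S then 1 else 0) := by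
    refine bernoulliExp_mono hp0 hp1 fun S hS => ?_
    have h0 := hf S hS
    split_ifs with h
    · have : 0 ≤ c⁻¹ * f S := by positivity
      linarith
    · have := hP S hS h
      have : 1 ≤ c⁻¹ * f S := by
        rw [inv_mul_eq_div, le_div_iff₀ hc]; linarith
      linarith
  rw [bernoulliExp_sub, bernoulliExp_const, bernoulliExp_const_mul, inv_mul_eq_div] at h
  exact h

theorem bernoulliExp_sq_sub (c : ℝ) : bernoulliExp p E (fun S => (f S - c) ^ 2) =
    bernoulliExp p E (fun S => (f S - bernoulliExp p E f) ^ 2) + (bernoulliExp p E f - c) ^ 2 := by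
  set m := bernoulliExp p E f with hm
  have h : (fun S => (f S - c) ^ 2) = fun S => (f S - m) ^ 2 + ((2 * (m - c)) * (f S - m) +
      (m - c) ^ 2) := by
    ext S; ring
  rw [h, bernoulliExp_add, bernoulliExp_add, bernoulliExp_const_mul, bernoulliExp_sub,
    bernoulliExp_const, bernoulliExp_const, ← hm]
  ring

variable [DecidableEq ι]

theorem bernoulliExp_insert {e : ι} (he : e ∉ E) (f : Finset ι → ℝ) :
    bernoulliExp p (insert e E) f =
      (1 - p) * bernoulliExp p E f + p * bernoulliExp p E (fun S => f (insert e S)) := by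
  unfold bernoulliExp
  rw [Finset.sum_powerset_insert he, Finset.mul_sum, Finset.mul_sum]
  congr 1
  · refine Finset.sum_congr rfl fun S hS => ?_
    have := Finset.card_le_card (Finset.mem_powerset.1 hS)
    rw [Finset.card_insert_of_notMem he, Nat.sub_add_comm this, pow_succ]
    ring
  · refine Finset.sum_congr rfl fun S hS => ?_
    have heS : e ∉ S := fun h => he (Finset.mem_powerset.1 hS h)
    rw [Finset.card_insert_of_notMem he, Finset.card_insert_of_notMem heS,
      Nat.add_sub_add_right, pow_succ]
    ring

/-- Independence: with the trace on `W` prescribed, the rest is a free subset of `E \ W`, whose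
weights sum to one. -/
theorem bernoulliExp_inter_eq {W U : Finset ι} (hWE : W ⊆ E) (hUW : U ⊆ W) :
    bernoulliExp p E (fun S => if S ∩ W = U then 1 else 0) =
      p ^ U.card * (1 - p) ^ (W.card - U.card) := by
  have h1 : bernoulliExp p E (fun S => if S ∩ W = U then 1 else 0) =
      ∑ T ∈ (E \ W).powerset, p ^ (U ∪ T).card * (1 - p) ^ (E.card - (U ∪ T).card) := by
    unfold bernoulliExp
    simp only [mul_ite, mul_one, mul_zero]
    rw [← Finset.sum_filter]
    refine Finset.sum_nbij' (fun S => S \ W) (fun T => U ∪ T) ?_ ?_ ?_ ?_ ?_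
    · intro S hS
      simp only [Finset.mem_filter, Finset.mem_powerset] at hS ⊢
      exact Finset.sdiff_subset_sdiff hS.1 subset_rfl
    · intro T hT
      simp only [Finset.mem_filter, Finset.mem_powerset] at hT ⊢
      refine ⟨Finset.union_subset (hUW.trans hWE) (hT.trans Finset.sdiff_subset), ?_⟩
      grind
    · intro S hS
      simp only [Finset.mem_filter, Finset.mem_powerset] at hS ⊢
      grind
    · intro T hT
      simp only [Finset.mem_powerset] at hT ⊢
      grind
    · intro S hS
      simp only [Finset.mem_filter, Finset.mem_powerset] at hS ⊢
      have : U ∪ S \ W = S := by grind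
      rw [this]
  have h2 := bernoulliExp_const (p := p) (E := E \ W) 1
  unfold bernoulliExp at h2
  refine h1.trans (Eq.trans ?_ (mul_one _))
  refine Eq.trans ?_ (congrArg (fun x => p ^ U.card * (1 - p) ^ (W.card - U.card) * x) h2)
  simp only [Finset.mul_sum]
  refine Finset.sum_congr rfl fun T hT => ?_
  rw [Finset.mem_powerset] at hT
  have hd : Disjoint U T := by
    rw [Finset.disjoint_left]
    intro x hx hxT
    exact (Finset.mem_sdiff.1 (hT hxT)).2 (hUW hx)
  have e1 := Finset.card_le_card hT
  have e2 := Finset.card_le_card hUW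
  have e3 := Finset.card_sdiff_add_card_eq_card hWE
  rw [Finset.card_union_of_disjoint hd, pow_add,
    show E.card - (U.card + T.card) = (W.card - U.card) + ((E \ W).card - T.card) by omega, pow_add]
  ring

theorem bernoulliExp_subset {W : Finset ι} (hWE : W ⊆ E) :
    bernoulliExp p E (fun S => if W ⊆ S then 1 else 0) = p ^ W.card := by
  have := bernoulliExp_inter_eq (p := p) hWE (subset_refl W)
  simpa [Finset.inter_eq_right] using this

theorem bernoulliExp_card : bernoulliExp p E (fun S => (S.card : ℝ)) = p * E.card := by
  have h : ∀ S ⊆ E, (S.card : ℝ) = ∑ e ∈ E, if ({e} : Finset ι) ⊆ S then 1 else 0 := by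
    intro S hS
    simp only [Finset.singleton_subset_iff]
    rw [← Finset.sum_filter, Finset.sum_const, nsmul_eq_mul, mul_one, Finset.filter_mem_eq_inter,
      Finset.inter_eq_right.2 hS]
  rw [bernoulliExp_congr h, bernoulliExp_sum, Finset.sum_congr rfl fun e he =>
    bernoulliExp_subset (Finset.singleton_subset_iff.2 he)]
  simp [mul_comm]

/-- The Efron–Stein inequality for functions that change by at most one when an element is
added. -/
theorem bernoulliExp_variance_le (hp0 : 0 ≤ p) (hp1 : p ≤ 1) (E : Finset ι) (f : Finset ι → ℝ)
    (hf : ∀ S, ∀ e ∉ S, |f (insert e S) - f S| ≤ 1) :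
    bernoulliExp p E (fun S => (f S - bernoulliExp p E f) ^ 2) ≤ p * E.card := by
  induction E using Finset.induction_on generalizing f with
  | empty => simp [bernoulliExp]
  | insert e E he ih =>
    have hm := bernoulliExp_insert (p := p) he f
    have ih0 := ih f hf
    -- off `E`, the shifted function is compared on sets that do not contain `e`
    have ih1 := ih (fun S => f (insert e S)) (fun S e' he' => by
      by_cases h : e' = e
      · subst h; simp
      · rw [Finset.insert_comm]
        exact hf _ _ (by simp [h, he']))
    have hd : |bernoulliExp p E (fun S => f (insert e S)) - bernoulliExp p E f| ≤ 1 := by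
      rw [← bernoulliExp_sub, abs_le]
      have hlow : bernoulliExp p E (fun _ => -1) ≤
          bernoulliExp p E (fun S => f (insert e S) - f S) :=
        bernoulliExp_mono hp0 hp1 fun S hS =>
          (abs_le.1 (hf S e fun h => he (hS h))).1
      have hup : bernoulliExp p E (fun S => f (insert e S) - f S) ≤
          bernoulliExp p E (fun _ => 1) :=
        bernoulliExp_mono hp0 hp1 fun S hS =>
          (abs_le.1 (hf S e fun h => he (hS h))).2
      rw [bernoulliExp_const] at hlow hup
      exact ⟨hlow, hup⟩
    rw [bernoulliExp_insert he, bernoulliExp_sq_sub (f := f),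
      bernoulliExp_sq_sub (f := fun S => f (insert e S)), hm, Finset.card_insert_of_notMem he]
    set A := bernoulliExp p E f
    set B := bernoulliExp p E (fun S => f (insert e S))
    have hsq : (B - A) ^ 2 ≤ 1 := by
      rw [← sq_abs]; nlinarith [abs_nonneg (B - A)]
    have h1p := sub_nonneg.2 hp1
    have i0 := mul_le_mul_of_nonneg_left ih0 h1p
    have i1 := mul_le_mul_of_nonneg_left ih1 hp0
    -- The variance of the conditional mean given whether `e` is present: it is `A` with probability
    -- `1 - p` and `B` with probability `p`. The Lipschitz condition gives `|B - A| ≤ 1`, so `e`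
    -- adds at most `p`.
    have i2 : (1 - p) * (A - ((1 - p) * A + p * B)) ^ 2 +
        p * (B - ((1 - p) * A + p * B)) ^ 2 = p * (1 - p) * (B - A) ^ 2 := by ring
    have i3 : p * (1 - p) * (B - A) ^ 2 ≤ p * 1 * 1 := by
      have : 1 - p ≤ 1 := by linarith
      gcongr
    push_cast
    nlinarith

/-- The absolute deviation has nonnegative variance, so the square of its mean is at most the
variance of `f`. -/
theorem bernoulliExp_abs_sub_le (hp0 : 0 ≤ p) (hp1 : p ≤ 1) (E : Finset ι) (f : Finset ι → ℝ)
    (hf : ∀ S, ∀ e ∉ S, |f (insert e S) - f S| ≤ 1) :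
    bernoulliExp p E (fun S => |f S - bernoulliExp p E f|) ≤ √(p * E.card) := by
  have hv := bernoulliExp_variance_le hp0 hp1 E f hf
  have h := bernoulliExp_sq_sub (p := p) (E := E)
    (f := fun S => |f S - bernoulliExp p E f|) 0
  simp only [sub_zero, sq_abs] at h
  have hnn : 0 ≤ bernoulliExp p E (fun S => (|f S - bernoulliExp p E f| -
      bernoulliExp p E (fun S => |f S - bernoulliExp p E f|)) ^ 2) := by
    have := bernoulliExp_mono (p := p) (E := E) hp0 hp1 (f := fun _ => 0) (g := fun S =>
      (|f S - bernoulliExp p E f| - bernoulliExp p E (fun S => |f S - bernoulliExp p E f|)) ^ 2)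
      (fun S _ => by positivity)
    rwa [bernoulliExp_const] at this
  exact Real.le_sqrt_of_sq_le (by linarith)

end Bernoulli

-- The only contact with measure theory. The law lives on subsets of the edge set of the complete
-- bipartite graph, which are the images of sets of pairs, so probabilities become finite sums.
open SimpleGraph in
theorem binomialRandomBipartite_real (n₁ n₂ : ℕ) (p : unitInterval)
    (A : Set (SimpleGraph (Fin n₁ ⊕ Fin n₂))) [DecidablePred (· ∈ A)] :
    (binomialRandomBipartite n₁ n₂ p).real A =
      bernoulliExp (p : ℝ) (Finset.univ : Finset (Fin n₁ × Fin n₂))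
        (fun S => if bip S ∈ A then 1 else 0) := by
  classical
  have hA : MeasurableSet A := by
    rw [← measurableEmbedding_edgeSet.measurableSet_image]
    exact (Set.toFinite _).measurableSet
  have hK : (completeBipartiteGraph (Fin n₁) (Fin n₂)).edgeSet =
      bipEdge '' ((Finset.univ : Finset (Fin n₁ × Fin n₂)) : Set (Fin n₁ × Fin n₂)) := by
    rw [← edgeSet_bip]
    congr 1
    ext u v
    rcases u with x | y <;> rcases v with x' | y' <;> simp
  rw [binomialRandomBipartite, map_measureReal_apply measurable_fromEdgeSet hA, measureReal_def,
    setBernoulli_apply_eq_apply_subsets, ← measureReal_def]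
  let F : Finset (Set (Sym2 (Fin n₁ ⊕ Fin n₂))) :=
    Finset.image (fun S : Finset (Fin n₁ × Fin n₂) => bipEdge '' (S : Set (Fin n₁ × Fin n₂)))
      (Finset.univ.filter fun S : Finset (Fin n₁ × Fin n₂) => bip S ∈ A)
  have hF : {s | s ∈ fromEdgeSet ⁻¹' A ∧ s ⊆ (completeBipartiteGraph (Fin n₁) (Fin n₂)).edgeSet} =
      (F : Set (Set (Sym2 (Fin n₁ ⊕ Fin n₂)))) := by
    ext s
    simp only [F, Set.mem_ofPred_eq, Finset.coe_image, Finset.coe_filter, Finset.mem_univ, true_and,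
      Set.mem_image, Set.mem_preimage, hK]
    constructor
    · rintro ⟨h1, h2⟩
      obtain ⟨t, -, rfl⟩ := Set.subset_image_iff.1 h2
      refine ⟨t.toFinset, ?_, by simp⟩
      rw [← fromEdgeSet_bipEdge]
      simpa using h1
    · rintro ⟨S, hS, rfl⟩
      rw [fromEdgeSet_bipEdge]
      exact ⟨hS, Set.image_mono (by simp)⟩
  have hinj : Function.Injective
      (fun S : Finset (Fin n₁ × Fin n₂) => bipEdge '' (S : Set (Fin n₁ × Fin n₂))) := by
    intro S T h
    exact Finset.coe_injective (bipEdge.injective.image_injective h)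
  have hsum : ∀ μ : Measure (Set (Sym2 (Fin n₁ ⊕ Fin n₂))), IsFiniteMeasure μ →
      μ.real (F : Set (Set (Sym2 (Fin n₁ ⊕ Fin n₂)))) = ∑ s ∈ F, μ.real {s} := by
    intro μ _
    rw [sum_measureReal_singleton]
  rw [hF, hsum _ inferInstance, Finset.sum_image (fun _ _ _ _ h => hinj h), Finset.sum_filter]
  unfold bernoulliExp
  rw [Finset.powerset_univ]
  refine Finset.sum_congr rfl fun S _ => ?_
  beta_reduce
  by_cases h : bip S ∈ A
  · rw [if_pos h, if_pos h, hK, setBernoulli_real_singleton p (Set.image_mono (by simp))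
      (Set.toFinite _), ← Set.image_sdiff bipEdge.injective,
      Set.ncard_image_of_injective _ bipEdge.injective,
      Set.ncard_image_of_injective _ bipEdge.injective, ← Finset.coe_sdiff, Set.ncard_coe_finset,
      Set.ncard_coe_finset, Finset.card_sdiff_of_subset (Finset.subset_univ S), mul_one]
  · rw [if_neg h, if_neg h, mul_zero]

/-! ### Short cycles: counting paths and a first moment bound. -/

namespace SimpleGraph

section Paths

theorem card_finsetWalkLength_succ_le {V : Type*} [DecidableEq V] (G : SimpleGraph V)
    [G.LocallyFinite] (n M : ℕ)
    (u v : V) (T : Finset V) (hT : ∀ w, G.Adj u w → w ∈ T)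
    (h : ∀ w ∈ T, (G.finsetWalkLength n w v).card ≤ M) :
    (G.finsetWalkLength (n + 1) u v).card ≤ T.card * M := by
  have hc : (Finset.univ : Finset (G.neighborSet u)).card ≤ T.card := by
    refine Finset.card_le_card_of_injOn (fun w => w.1) (fun w _ => hT _ w.2)
      (fun _ _ _ _ h => Subtype.ext h)
  refine (Finset.card_biUnion_le_card_mul _ _ M fun w _ => ?_).trans (Nat.mul_le_mul_right M hc)
  rw [Finset.card_map]
  exact h _ (hT _ w.2)

variable {α β : Type*}

theorem even_length_bip {S : Finset (α × β)} {u v : α ⊕ β} (w : (bip S).Walk u v) :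
    Even w.length ↔ (u.isLeft = v.isLeft) := by
  induction w with
  | nil => simp
  | @cons a b c h p ih =>
    rw [Walk.length_cons, Nat.even_add_one, ih]
    rcases a with a | a <;> rcases b with b | b <;> rcases c with c | c <;> simp at h ⊢

variable [Fintype α] [Fintype β] [DecidableEq α] [DecidableEq β]

-- Such a walk has `2k` inner vertices, alternating between the classes, so two further steps cost a
-- factor `|α| |β|`.
open Classical in
theorem card_finsetWalkLength_bip_le (k : ℕ) (x : α) (y : β) :
    ((bip (Finset.univ : Finset (α × β))).finsetWalkLength (2 * k + 1)
      (Sum.inl x) (Sum.inr y)).card ≤ (Fintype.card α * Fintype.card β) ^ k := by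
  induction k generalizing x y with
  | zero =>
    rw [pow_zero, Finset.card_le_one]
    intro w hw w' hw'
    rw [mem_finsetWalkLength_iff] at hw hw'
    cases w with
    | cons h p =>
      cases w' with
      | cons h' p' =>
        simp only [Walk.length_cons] at hw hw'
        obtain rfl := (Walk.eq_of_length_eq_zero (p := p) (by omega))
        obtain rfl := (Walk.eq_of_length_eq_zero (p := p') (by omega))
        have e1 : p = Walk.nil := by cases p with | nil => rfl | cons _ _ => simp at hw
        have e2 : p' = Walk.nil := by cases p' with | nil => rfl | cons _ _ => simp at hw'
        rw [e1, e2]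
  | succ k ih =>
    rw [show 2 * (k + 1) + 1 = (2 * k + 1) + 1 + 1 by ring]
    refine (card_finsetWalkLength_succ_le (bip Finset.univ) _
      (Fintype.card α * (Fintype.card α * Fintype.card β) ^ k) _ _
      (Finset.univ.map ⟨Sum.inr, Sum.inr_injective⟩) ?_ ?_).trans ?_
    · rintro (a | b) h
      · simp at h
      · simp
    · intro w hw
      obtain ⟨b, -, rfl⟩ := Finset.mem_map.1 hw
      refine (card_finsetWalkLength_succ_le (bip Finset.univ) _
        ((Fintype.card α * Fintype.card β) ^ k) _ _
        (Finset.univ.map ⟨Sum.inl, Sum.inl_injective⟩) ?_ ?_).trans ?_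
      · rintro (a | b) h
        · simp
        · simp at h
      · intro w hw
        obtain ⟨a, -, rfl⟩ := Finset.mem_map.1 hw
        exact ih a y
      · simp
    · simp only [Finset.card_map, Finset.card_univ]
      exact le_of_eq (by ring)

/-- The set of edges of a walk in a bipartite graph, as pairs. -/
noncomputable def walkEdges {S : Finset (α × β)} {u v : α ⊕ β} (w : (bip S).Walk u v) :
    Finset (α × β) :=
  Finset.univ.filter fun e => bipEdge e ∈ w.edges

theorem mem_walkEdges {S : Finset (α × β)} {u v : α ⊕ β} (w : (bip S).Walk u v) (e : α × β) :
    e ∈ walkEdges w ↔ bipEdge e ∈ w.edges := by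
  simp [walkEdges]

theorem card_walkEdges {S : Finset (α × β)} {u v : α ⊕ β} (w : (bip S).Walk u v)
    (hw : w.IsPath) : (walkEdges w).card = w.length := by
  rw [← Walk.length_edges, ← List.toFinset_card_of_nodup hw.isTrail.edges_nodup,
    ← Finset.card_map bipEdge]
  congr 1
  ext e
  simp only [Finset.mem_map, mem_walkEdges, List.mem_toFinset]
  constructor
  · rintro ⟨e, he, rfl⟩; exact he
  · intro he
    have := w.edges_subset_edgeSet he
    rw [edgeSet_bip] at this
    obtain ⟨e', -, rfl⟩ := this
    exact ⟨e', he, rfl⟩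

-- Union bound: an edge and a path of length `2k + 1` avoiding it form `2k + 2` distinct edges, all
-- present with probability `p ^ (2k + 2)`, and there are at most `(|α| |β|) ^ (k + 1)` such pairs.
-- Every short edge has such a path with `2k + 1 ≤ L`, so the range of `k` is more than sufficient.
open Classical in
theorem bernoulliExp_card_shortEdges_le {p : ℝ} (hp0 : 0 ≤ p) (hp1 : p ≤ 1) (L : ℕ) :
    bernoulliExp p (Finset.univ : Finset (α × β)) (fun S => ((shortEdges S L).card : ℝ)) ≤
      ∑ k ∈ Finset.range (L + 1), (Fintype.card α * Fintype.card β * p ^ 2) ^ (k + 1) := by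
  let K := bip (Finset.univ : Finset (α × β))
  let P : (e : α × β) → ℕ → Finset (K.Walk (Sum.inl e.1) (Sum.inr e.2)) := fun e k =>
    (K.finsetWalkLength (2 * k + 1) (Sum.inl e.1) (Sum.inr e.2)).filter
      fun w => w.IsPath ∧ bipEdge e ∉ w.edges
  have h1 : ∀ S ⊆ (Finset.univ : Finset (α × β)), ((shortEdges S L).card : ℝ) ≤
      ∑ e : α × β, ∑ k ∈ Finset.range (L + 1), ∑ w ∈ P e k,
        if insert e (walkEdges w) ⊆ S then 1 else 0 := by
    intro S _
    rw [Finset.cast_card, ← Finset.sum_filter_add_sum_filter_not Finset.univ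
      (fun e => e ∈ shortEdges S L)]
    have hnn : ∀ e, (0 : ℝ) ≤ ∑ k ∈ Finset.range (L + 1), ∑ w ∈ P e k,
        if insert e (walkEdges w) ⊆ S then 1 else 0 := fun e =>
      Finset.sum_nonneg fun k _ => Finset.sum_nonneg fun w _ => by split_ifs <;> norm_num
    refine le_add_of_le_of_nonneg ?_ (Finset.sum_nonneg fun e _ => hnn e)
    have hfil : (Finset.univ.filter fun e => e ∈ shortEdges S L) = shortEdges S L := by
      ext; simp
    rw [hfil]
    refine Finset.sum_le_sum fun e he => ?_
    obtain ⟨heS, w, hw, hwL, hwe⟩ := Finset.mem_filter.1 he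
    have hodd : ¬ Even w.length := by rw [even_length_bip]; simp
    obtain ⟨k, hk⟩ := Nat.not_even_iff_odd.1 hodd
    let w' : K.Walk (Sum.inl e.1) (Sum.inr e.2) := w.mapLe (bip_mono (Finset.subset_univ S))
    have hw' : w' ∈ P e k := by
      refine Finset.mem_filter.2 ⟨?_, hw.mapLe _, by simpa [w'] using hwe⟩
      rw [mem_finsetWalkLength_iff]
      simpa [w'] using hk
    have hsub : insert e (walkEdges w') ⊆ S := by
      refine Finset.insert_subset heS fun e' he' => ?_
      rw [mem_walkEdges] at he'
      have h : bipEdge e' ∈ w.edges := by simpa [w'] using he'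
      have := w.edges_subset_edgeSet h
      rw [edgeSet_bip] at this
      simpa using this
    calc (1 : ℝ) = if insert e (walkEdges w') ⊆ S then 1 else 0 := by rw [if_pos hsub]
      _ ≤ ∑ w ∈ P e k, if insert e (walkEdges w) ⊆ S then 1 else 0 :=
        Finset.single_le_sum (f := fun w => if insert e (walkEdges w) ⊆ S then (1 : ℝ) else 0)
          (fun w _ => by split_ifs <;> norm_num) hw'
      _ ≤ _ := Finset.single_le_sum (f := fun k => ∑ w ∈ P e k,
          if insert e (walkEdges w) ⊆ S then (1 : ℝ) else 0)
          (fun k _ => Finset.sum_nonneg fun w _ => by split_ifs <;> norm_num)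
          (Finset.mem_range.2 (by omega))
  refine (bernoulliExp_mono hp0 hp1 h1).trans ?_
  rw [bernoulliExp_sum]
  simp only [bernoulliExp_sum]
  rw [Finset.sum_comm]
  refine Finset.sum_le_sum fun k _ => ?_
  have h2 : ∀ e : α × β, ∑ w ∈ P e k, bernoulliExp p Finset.univ
      (fun S => if insert e (walkEdges w) ⊆ S then (1 : ℝ) else 0) ≤
      (Fintype.card α * Fintype.card β : ℝ) ^ k * p ^ (2 * k + 2) := by
    intro e
    have h3 : ∀ w ∈ P e k, bernoulliExp p Finset.univ
        (fun S => if insert e (walkEdges w) ⊆ S then (1 : ℝ) else 0) = p ^ (2 * k + 2) := by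
      intro w hw
      obtain ⟨hw1, hw2, hw3⟩ := Finset.mem_filter.1 hw
      rw [bernoulliExp_subset (Finset.subset_univ _), Finset.card_insert_of_notMem
        (by rwa [mem_walkEdges]), card_walkEdges w hw2, mem_finsetWalkLength_iff.1 hw1]
    rw [Finset.sum_congr rfl h3, Finset.sum_const, nsmul_eq_mul]
    refine mul_le_mul_of_nonneg_right ?_ (by positivity)
    have : (P e k).card ≤ _ := (Finset.card_filter_le _ _).trans (card_finsetWalkLength_bip_le k e.1 e.2)
    exact_mod_cast this
  refine (Finset.sum_le_sum fun e _ => h2 e).trans (le_of_eq ?_)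
  rw [Finset.sum_const, Finset.card_univ, Fintype.card_prod, nsmul_eq_mul]
  push_cast
  ring

end Paths

end SimpleGraph

/-! ### Components with given class sizes and their expected number. -/

namespace SimpleGraph

open Classical in
/-- The edge sets of the connected bipartite graphs with `r` and `s` labelled vertices. -/
noncomputable def connSets (r s : ℕ) : Finset (Finset (Fin r × Fin s)) :=
  Finset.univ.filter fun U => (bip U).Connected

theorem mem_connSets {r s : ℕ} {U : Finset (Fin r × Fin s)} :
    U ∈ connSets r s ↔ (bip U).Connected := by
  simp [connSets]

/-- The number of labelled trees with bipartition classes of sizes `r` and `s`. -/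
noncomputable def numTrees (r s : ℕ) : ℕ :=
  ((connSets r s).filter fun U => U.card + 1 = r + s).card

theorem le_card_add_one_of_mem_connSets {r s : ℕ} {U : Finset (Fin r × Fin s)}
    (hU : U ∈ connSets r s) : r + s ≤ U.card + 1 := by
  have := (mem_connSets.1 hU).card_vert_le_card_edgeSet_add_one
  rw [card_edgeSet_bip] at this
  simpa using this

theorem exists_embedding_map_univ_eq {γ : Type*} {k : ℕ} (A : Finset γ) (hA : A.card = k) :
    ∃ f : Fin k ↪ γ, Finset.univ.map f = A := by
  refine ⟨(A.equivFinOfCardEq hA).symm.toEmbedding.trans (Function.Embedding.subtype _), ?_⟩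
  ext x
  simp only [Finset.mem_map, Finset.mem_univ, true_and]
  constructor
  · rintro ⟨i, rfl⟩; simp
  · intro hx; exact ⟨A.equivFinOfCardEq hA ⟨x, hx⟩, by simp⟩

section Components

variable {α β : Type*}

/-- Every edge of `S` touching the embedded vertex set comes from `U`, so a walk that starts there
cannot leave and can be pulled back. -/
theorem exists_preimage_of_reachable {r s : ℕ} {S : Finset (α × β)} {U : Finset (Fin r × Fin s)}
    (f : Fin r ↪ α) (g : Fin s ↪ β)
    (hS : ∀ e ∈ S, e.1 ∈ Set.range f ∨ e.2 ∈ Set.range g → e ∈ U.map (f.prodMap g))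
    {u : Fin r ⊕ Fin s} {v : α ⊕ β} (h : (bip S).Reachable (Sum.map f g u) v) :
    ∃ w, v = Sum.map f g w ∧ (bip U).Reachable u w := by
  obtain ⟨p⟩ := h
  generalize hz : Sum.map f g u = z at p
  induction p generalizing u with
  | nil => exact ⟨u, hz.symm, Reachable.refl _⟩
  | @cons a b c h p ih =>
    subst hz
    obtain ⟨e, he, hab⟩ := h
    have he' : e ∈ U.map (f.prodMap g) := by
      refine hS e he ?_
      rcases hab with ⟨h1, -⟩ | ⟨-, h1⟩ <;> rcases u with x | y <;> simp at h1
      · exact Or.inl ⟨x, h1⟩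
      · exact Or.inr ⟨y, h1⟩
    obtain ⟨⟨x, y⟩, hxy, rfl⟩ := Finset.mem_map.1 he'
    rcases hab with ⟨h1, h2⟩ | ⟨h1, h2⟩ <;> rcases u with x' | y' <;> simp at h1 h2
    · subst h2
      obtain rfl : x' = x := h1
      obtain ⟨w, hw, hw'⟩ := ih (u := Sum.inr y) rfl
      exact ⟨w, hw, (Adj.reachable (by simpa using hxy)).trans hw'⟩
    · subst h1
      obtain rfl : y' = y := h2
      obtain ⟨w, hw, hw'⟩ := ih (u := Sum.inl x) rfl
      exact ⟨w, hw, (Adj.reachable (by simpa using hxy)).trans hw'⟩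

open Classical in
/-- The vertices of a component in the first class. -/
noncomputable def leftPart [Fintype α] {S : Finset (α × β)} (c : (bip S).ConnectedComponent) : Finset α :=
  Finset.univ.filter fun x => (bip S).connectedComponentMk (Sum.inl x) = c

open Classical in
/-- The vertices of a component in the second class. -/
noncomputable def rightPart [Fintype β] {S : Finset (α × β)} (c : (bip S).ConnectedComponent) : Finset β :=
  Finset.univ.filter fun y => (bip S).connectedComponentMk (Sum.inr y) = c

theorem mem_leftPart [Fintype α] {S : Finset (α × β)} {c : (bip S).ConnectedComponent} {x : α} :
    x ∈ leftPart c ↔ (bip S).connectedComponentMk (Sum.inl x) = c := by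
  simp [leftPart]

theorem mem_rightPart [Fintype β] {S : Finset (α × β)} {c : (bip S).ConnectedComponent} {y : β} :
    y ∈ rightPart c ↔ (bip S).connectedComponentMk (Sum.inr y) = c := by
  simp [rightPart]

variable [Fintype α] [Fintype β]

theorem parts_injective {S : Finset (α × β)} :
    Function.Injective fun c : (bip S).ConnectedComponent => (leftPart c, rightPart c) := by
  intro c c' h
  simp only [Prod.mk.injEq] at h
  induction c using ConnectedComponent.ind with | h u =>
  rcases u with x | y
  · exact mem_leftPart.1 (h.1 ▸ mem_leftPart.2 rfl)
  · exact mem_rightPart.1 (h.2 ▸ mem_rightPart.2 rfl)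

theorem card_parts_pos {S : Finset (α × β)} (c : (bip S).ConnectedComponent) :
    0 < (leftPart c).card + (rightPart c).card := by
  induction c using ConnectedComponent.ind with | h u =>
  rcases u with x | y
  · exact Nat.add_pos_left (Finset.card_pos.2 ⟨x, mem_leftPart.2 rfl⟩) _
  · exact Nat.add_pos_right _ (Finset.card_pos.2 ⟨y, mem_rightPart.2 rfl⟩)

open Classical in
theorem sum_card_parts (S : Finset (α × β)) :
    ∑ c : (bip S).ConnectedComponent, ((leftPart c).card + (rightPart c).card) =
      Fintype.card α + Fintype.card β := by
  rw [Finset.sum_add_distrib, ← Finset.card_univ, ← Finset.card_univ,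
    Finset.card_eq_sum_card_fiberwise (f := fun x => (bip S).connectedComponentMk (Sum.inl x))
      (t := Finset.univ) (by simp),
    Finset.card_eq_sum_card_fiberwise (f := fun y => (bip S).connectedComponentMk (Sum.inr y))
      (t := Finset.univ) (by simp)]
  congr 1

open Classical in
/-- The number of components with `r` vertices in the first class and `s` in the second. -/
noncomputable def compCount (S : Finset (α × β)) (r s : ℕ) : ℕ :=
  (Finset.univ.filter fun c : (bip S).ConnectedComponent =>
    (leftPart c).card = r ∧ (rightPart c).card = s).card

open Classical in
theorem sum_compCount (S : Finset (α × β)) (k : ℕ) :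
    ∑ x ∈ Finset.HasAntidiagonal.antidiagonal k, compCount S x.1 x.2 =
      (Finset.univ.filter fun c : (bip S).ConnectedComponent =>
        (leftPart c).card + (rightPart c).card = k).card := by
  rw [Finset.card_eq_sum_card_fiberwise (f := fun c : (bip S).ConnectedComponent =>
    ((leftPart c).card, (rightPart c).card)) (t := Finset.HasAntidiagonal.antidiagonal k)
    (by intro c hc; simpa using hc)]
  refine Finset.sum_congr rfl fun x hx => ?_
  rw [Finset.HasAntidiagonal.mem_antidiagonal] at hx
  unfold compCount
  congr 1
  ext c
  simp only [Finset.mem_filter, Finset.mem_univ, true_and, Prod.ext_iff]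
  constructor
  · rintro ⟨h1, h2⟩; exact ⟨by omega, h1, h2⟩
  · rintro ⟨-, h⟩; exact h

open Classical in
theorem sum_range_compCount (S : Finset (α × β)) (K : ℕ) :
    ∑ k ∈ Finset.range K, ∑ x ∈ Finset.HasAntidiagonal.antidiagonal (k + 1), compCount S x.1 x.2 =
      (Finset.univ.filter fun c : (bip S).ConnectedComponent =>
        (leftPart c).card + (rightPart c).card ≤ K).card := by
  rw [Finset.card_eq_sum_card_fiberwise (f := fun c : (bip S).ConnectedComponent =>
    (leftPart c).card + (rightPart c).card - 1) (t := Finset.range K)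
    (by
      intro c hc
      have := card_parts_pos c
      simp only [Finset.coe_filter, Finset.mem_univ, true_and, Set.mem_ofPred_eq] at hc
      simp only [Finset.coe_range, Set.mem_Iio]
      omega)]
  refine Finset.sum_congr rfl fun k hk => ?_
  rw [sum_compCount]
  rw [Finset.mem_range] at hk
  congr 1
  ext c
  have := card_parts_pos c
  simp only [Finset.mem_filter, Finset.mem_univ, true_and]
  omega

theorem sum_compCount_le (S : Finset (α × β)) (K : ℕ) :
    ∑ k ∈ Finset.range K, ∑ x ∈ Finset.HasAntidiagonal.antidiagonal (k + 1), compCount S x.1 x.2 ≤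
      Nat.card (bip S).ConnectedComponent := by
  classical
  rw [sum_range_compCount, Nat.card_eq_fintype_card]
  exact Finset.card_le_univ _

/-- Components with more than `K` vertices are disjoint, so there are at most `(|α| + |β|) / (K +
1)` of them. The bound is uniform in `S`, which later allows limit and sum to be exchanged. -/
theorem card_connectedComponent_le_sum_compCount (S : Finset (α × β)) (K : ℕ) :
    (Nat.card (bip S).ConnectedComponent : ℝ) ≤
      ∑ k ∈ Finset.range K, ∑ x ∈ Finset.HasAntidiagonal.antidiagonal (k + 1), (compCount S x.1 x.2 : ℝ) +
        (Fintype.card α + Fintype.card β) / (K + 1) := by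
  classical
  have h1 := sum_range_compCount S K
  have h2 : (Finset.univ.filter fun c : (bip S).ConnectedComponent =>
      ¬ (leftPart c).card + (rightPart c).card ≤ K).card * (K + 1) ≤
      Fintype.card α + Fintype.card β := by
    rw [← sum_card_parts S, ← smul_eq_mul]
    refine (Finset.card_nsmul_le_sum _ _ _ fun c hc => ?_).trans
      (Finset.sum_le_sum_of_subset (Finset.filter_subset _ _))
    have := (Finset.mem_filter.1 hc).2
    omega
  have h3 := Finset.card_filter_add_card_filter_not (s := Finset.univ)
    (fun c : (bip S).ConnectedComponent => (leftPart c).card + (rightPart c).card ≤ K)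
  rw [← h1, Finset.card_univ, ← Nat.card_eq_fintype_card] at h3
  have h4 : ((Finset.univ.filter fun c : (bip S).ConnectedComponent =>
      ¬ (leftPart c).card + (rightPart c).card ≤ K).card : ℝ) ≤
        (Fintype.card α + Fintype.card β) / (K + 1) := by
    rw [le_div_iff₀ (by positivity)]
    exact_mod_cast h2
  rw [← h3]
  push_cast
  linarith

variable [DecidableEq α] [DecidableEq β]

-- Whether a given vertex set is a component depends only on the edges touching it: they must stay
-- inside and connect it. The event is thus a disjoint union of events fixing the trace of `S`, each
-- with known probability.
open Classical in
theorem exists_component_iff {r s : ℕ} (f : Fin r ↪ α) (g : Fin s ↪ β) (S : Finset (α × β)) :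
    (∃ c : (bip S).ConnectedComponent,
        leftPart c = Finset.univ.map f ∧ rightPart c = Finset.univ.map g) ↔
      ∃ U ∈ connSets r s, S ∩ (Finset.univ.filter fun e : α × β =>
        e.1 ∈ Set.range f ∨ e.2 ∈ Set.range g) = U.map (f.prodMap g) := by
  constructor
  · rintro ⟨c, hc1, hc2⟩
    have hl : ∀ x, (bip S).connectedComponentMk (Sum.inl x) = c ↔ x ∈ Set.range f := by
      intro x; rw [← mem_leftPart, hc1]; simp
    have hr : ∀ y, (bip S).connectedComponentMk (Sum.inr y) = c ↔ y ∈ Set.range g := by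
      intro y; rw [← mem_rightPart, hc2]; simp
    let U : Finset (Fin r × Fin s) := Finset.univ.filter fun e => (f e.1, g e.2) ∈ S
    have hU : ∀ e ∈ S, e.1 ∈ Set.range f ∨ e.2 ∈ Set.range g → e ∈ U.map (f.prodMap g) := by
      rintro ⟨x, y⟩ he h
      have hadj : (bip S).connectedComponentMk (Sum.inl x) =
          (bip S).connectedComponentMk (Sum.inr y) :=
        ConnectedComponent.sound (Adj.reachable (by simpa using he))
      have h' : x ∈ Set.range f ∧ y ∈ Set.range g := by
        rw [← hl, ← hr, hadj, and_self]
        rcases h with h | h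
        · rw [← hadj]; exact (hl x).2 h
        · exact (hr y).2 h
      obtain ⟨⟨i, rfl⟩, ⟨j, rfl⟩⟩ := h'
      exact Finset.mem_map.2 ⟨(i, j), by simpa [U] using he, rfl⟩
    have hmk : ∀ u, (bip S).connectedComponentMk (Sum.map f g u) = c := by
      rintro (i | j)
      · exact (hl _).2 ⟨i, rfl⟩
      · exact (hr _).2 ⟨j, rfl⟩
    refine ⟨U, mem_connSets.2 ?_, ?_⟩
    · have hpre : (bip U).Preconnected := by
        intro u v
        obtain ⟨w, hw, hw'⟩ := exists_preimage_of_reachable f g hU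
          (ConnectedComponent.exact ((hmk u).trans (hmk v).symm))
        obtain rfl := (Function.Injective.sumMap f.injective g.injective) hw
        exact hw'
      have hne : Nonempty (Fin r ⊕ Fin s) := by
        induction c using ConnectedComponent.ind with | h u =>
        rcases u with x | y
        · obtain ⟨i, -⟩ := (hl x).1 rfl; exact ⟨Sum.inl i⟩
        · obtain ⟨i, -⟩ := (hr y).1 rfl; exact ⟨Sum.inr i⟩
      exact { preconnected := hpre, nonempty := hne }
    · ext e
      simp only [Finset.mem_inter, Finset.mem_filter, Finset.mem_univ, true_and]
      constructor
      · rintro ⟨h1, h2⟩; exact hU e h1 h2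
      · intro h
        obtain ⟨⟨i, j⟩, hij, rfl⟩ := Finset.mem_map.1 h
        exact ⟨by simpa [U] using hij, Or.inl ⟨i, rfl⟩⟩
  · rintro ⟨U, hU, hSU⟩
    rw [mem_connSets] at hU
    have hS : ∀ e ∈ S, e.1 ∈ Set.range f ∨ e.2 ∈ Set.range g → e ∈ U.map (f.prodMap g) := by
      intro e he h
      rw [← hSU]
      simp only [Finset.mem_inter, Finset.mem_filter, Finset.mem_univ, true_and]
      exact ⟨he, h⟩
    have hUS : U.map (f.prodMap g) ⊆ S := by rw [← hSU]; exact Finset.inter_subset_left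
    let φ : bip U →g bip S :=
      { toFun := Sum.map f g
        map_rel' := by
          rintro u v ⟨e, he, h⟩
          refine ⟨(f e.1, g e.2), hUS (Finset.mem_map.2 ⟨e, he, rfl⟩), ?_⟩
          rcases h with ⟨rfl, rfl⟩ | ⟨rfl, rfl⟩
          · exact Or.inl ⟨rfl, rfl⟩
          · exact Or.inr ⟨rfl, rfl⟩ }
    obtain ⟨u₀⟩ := hU.nonempty
    refine ⟨(bip S).connectedComponentMk (Sum.map f g u₀), ?_, ?_⟩
    · ext x
      rw [mem_leftPart]
      simp only [Finset.mem_map, Finset.mem_univ, true_and]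
      constructor
      · intro h
        obtain ⟨w, hw, -⟩ := exists_preimage_of_reachable f g hS (ConnectedComponent.exact h.symm)
        rcases w with i | j <;> simp at hw
        exact ⟨i, hw.symm⟩
      · rintro ⟨i, rfl⟩
        exact ConnectedComponent.sound ((hU.preconnected (Sum.inl i) u₀).map φ)
    · ext y
      rw [mem_rightPart]
      simp only [Finset.mem_map, Finset.mem_univ, true_and]
      constructor
      · intro h
        obtain ⟨w, hw, -⟩ := exists_preimage_of_reachable f g hS (ConnectedComponent.exact h.symm)
        rcases w with i | j <;> simp at hw
        exact ⟨j, hw.symm⟩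
      · rintro ⟨j, rfl⟩
        exact ConnectedComponent.sound ((hU.preconnected (Sum.inr j) u₀).map φ)

open Classical in
theorem bernoulliExp_exists_component {r s : ℕ} (p : ℝ) (f : Fin r ↪ α) (g : Fin s ↪ β) :
    bernoulliExp p (Finset.univ : Finset (α × β)) (fun S =>
      if ∃ c : (bip S).ConnectedComponent,
        leftPart c = Finset.univ.map f ∧ rightPart c = Finset.univ.map g then 1 else 0) =
      ∑ U ∈ connSets r s, p ^ U.card * (1 - p) ^
        (Fintype.card α * Fintype.card β - (Fintype.card α - r) * (Fintype.card β - s) -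
          U.card) := by
  set W : Finset (α × β) := Finset.univ.filter fun e : α × β =>
    e.1 ∈ Set.range f ∨ e.2 ∈ Set.range g with hW
  have hWcard : W.card =
      Fintype.card α * Fintype.card β - (Fintype.card α - r) * (Fintype.card β - s) := by
    -- The pairs that miss the vertex set form a product of complements, which gives the exponent of
    -- `1 - p`.
    have hc : Wᶜ = (Finset.univ.map f)ᶜ ×ˢ (Finset.univ.map g)ᶜ := by
      ext e
      simp [hW, not_or]
    have h1 := Finset.card_compl W
    have h2 := Finset.card_le_univ W
    rw [hc, Finset.card_product, Finset.card_compl, Finset.card_compl, Finset.card_map,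
      Finset.card_map, Finset.card_univ, Finset.card_univ, Fintype.card_fin, Fintype.card_fin,
      Fintype.card_prod] at h1
    rw [Fintype.card_prod] at h2
    omega
  have hsum : ∀ S ⊆ (Finset.univ : Finset (α × β)),
      (if ∃ c : (bip S).ConnectedComponent,
        leftPart c = Finset.univ.map f ∧ rightPart c = Finset.univ.map g then (1 : ℝ) else 0) =
      ∑ U ∈ connSets r s, if S ∩ W = U.map (f.prodMap g) then 1 else 0 := by
    intro S _
    rw [if_congr (exists_component_iff f g S) rfl rfl]
    by_cases h : ∃ U ∈ connSets r s, S ∩ W = U.map (f.prodMap g)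
    · rw [if_pos h]
      obtain ⟨U, hU, hSU⟩ := h
      rw [Finset.sum_eq_single_of_mem U hU, if_pos hSU]
      intro U' _ hne
      rw [if_neg]
      intro h'
      exact hne (Finset.map_injective _ (h'.symm.trans hSU))
    · rw [if_neg h]
      push Not at h
      exact (Finset.sum_eq_zero fun U hU => if_neg (h U hU)).symm
  rw [bernoulliExp_congr hsum, bernoulliExp_sum]
  refine Finset.sum_congr rfl fun U _ => ?_
  rw [bernoulliExp_inter_eq (Finset.subset_univ W) ?_, Finset.card_map, hWcard]
  intro e he
  obtain ⟨⟨i, j⟩, -, rfl⟩ := Finset.mem_map.1 he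
  exact Finset.mem_filter.2 ⟨Finset.mem_univ _, Or.inl ⟨i, rfl⟩⟩

theorem bernoulliExp_compCount (p : ℝ) (r s : ℕ) :
    bernoulliExp p (Finset.univ : Finset (α × β)) (fun S => (compCount S r s : ℝ)) =
      (Fintype.card α).choose r * (Fintype.card β).choose s *
      ∑ U ∈ connSets r s, p ^ U.card * (1 - p) ^
        (Fintype.card α * Fintype.card β - (Fintype.card α - r) * (Fintype.card β - s) -
          U.card) := by
  classical
  have h : ∀ S ⊆ (Finset.univ : Finset (α × β)), (compCount S r s : ℝ) =
      ∑ X ∈ (Finset.univ : Finset α).powersetCard r ×ˢ (Finset.univ : Finset β).powersetCard s,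
        if ∃ c : (bip S).ConnectedComponent, leftPart c = X.1 ∧ rightPart c = X.2
          then 1 else 0 := by
    intro S _
    rw [← Finset.sum_filter, Finset.sum_const, nsmul_eq_mul, mul_one, compCount,
      ← Finset.card_image_of_injective _ parts_injective]
    congr 2
    ext ⟨A, B⟩
    simp only [Finset.mem_image, Finset.mem_filter, Finset.mem_univ, true_and, Finset.mem_product,
      Finset.mem_powersetCard, Finset.subset_univ, Prod.mk.injEq]
    constructor
    · rintro ⟨c, ⟨h1, h2⟩, rfl, rfl⟩; exact ⟨⟨h1, h2⟩, c, rfl, rfl⟩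
    · rintro ⟨⟨h1, h2⟩, c, rfl, rfl⟩; exact ⟨c, ⟨h1, h2⟩, rfl, rfl⟩
  rw [bernoulliExp_congr h, bernoulliExp_sum, Finset.sum_congr rfl (g := fun _ =>
    ∑ U ∈ connSets r s, p ^ U.card * (1 - p) ^
        (Fintype.card α * Fintype.card β - (Fintype.card α - r) * (Fintype.card β - s) -
          U.card))]
  · rw [Finset.sum_const, Finset.card_product, Finset.card_powersetCard,
      Finset.card_powersetCard, nsmul_eq_mul, Finset.card_univ, Finset.card_univ]
    push_cast
    ring
  · rintro ⟨A, B⟩ hX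
    simp only [Finset.mem_product, Finset.mem_powersetCard] at hX
    obtain ⟨f, rfl⟩ := exists_embedding_map_univ_eq A hX.1.2
    obtain ⟨g, rfl⟩ := exists_embedding_map_univ_eq B hX.2.2
    exact bernoulliExp_exists_component p f g

end Components

end SimpleGraph

/-! ### Limits in the sparse regime. -/

theorem tendsto_one_sub_pow {p : ℕ → ℝ} {e : ℕ → ℕ} {c : ℝ}
    (hp : Tendsto p atTop (𝓝 0)) (he : Tendsto (fun i => p i * e i) atTop (𝓝 c)) :
    Tendsto (fun i => (1 - p i) ^ e i) atTop (𝓝 (Real.exp (-c))) := by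
  have hlt : ∀ᶠ i in atTop, p i < 1 := hp.eventually (gt_mem_nhds one_pos)
  have h1 : Tendsto (fun i => e i * Real.log (1 - p i)) atTop (𝓝 (-c)) := by
    have hlow : Tendsto (fun i => -(p i * e i * (1 - p i)⁻¹)) atTop (𝓝 (-(c * (1 - 0)⁻¹))) :=
      (he.mul ((hp.const_sub 1).inv₀ (by norm_num))).neg
    rw [show -(c * (1 - 0)⁻¹) = -c by norm_num] at hlow
    -- The bounds are `1 - x⁻¹ ≤ log x ≤ x - 1` at `x = 1 - p`.
    refine tendsto_of_tendsto_of_tendsto_of_le_of_le' hlow he.neg ?_ ?_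
    · filter_upwards [hlt] with i hi
      have hpos : 0 < 1 - p i := by linarith
      have := mul_le_mul_of_nonneg_left (Real.one_sub_inv_le_log_of_pos hpos)
        (Nat.cast_nonneg (α := ℝ) (e i))
      refine le_trans (le_of_eq ?_) this
      field_simp
      ring
    · filter_upwards [hlt] with i hi
      have hpos : 0 < 1 - p i := by linarith
      have := mul_le_mul_of_nonneg_left (Real.log_le_sub_one_of_pos hpos)
        (Nat.cast_nonneg (α := ℝ) (e i))
      linarith
  refine ((Real.continuous_exp.tendsto _).comp h1).congr' ?_
  filter_upwards [hlt] with i hi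
  have hpos : 0 < 1 - p i := by linarith
  rw [Function.comp_apply, Real.exp_nat_mul, Real.exp_log hpos]

theorem tendsto_choose_mul_pow {p : ℕ → ℝ} {n : ℕ → ℕ} {a : ℝ}
    (hp : Tendsto p atTop (𝓝 0)) (hn : Tendsto (fun i => p i * n i) atTop (𝓝 a))
    (hn' : Tendsto n atTop atTop) (r : ℕ) :
    Tendsto (fun i => ((n i).choose r : ℝ) * p i ^ r) atTop (𝓝 (a ^ r / r.factorial)) := by
  induction r with
  | zero => simp
  | succ r ih =>
    have h := (ih.mul (hn.sub (hp.mul_const (r : ℝ)))).div_const ((r : ℝ) + 1)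
    have hlim : a ^ r / (r.factorial : ℝ) * (a - 0 * r) / (r + 1) =
        a ^ (r + 1) / ((r + 1).factorial : ℝ) := by
      rw [Nat.factorial_succ]
      push_cast
      field_simp
      ring
    rw [hlim] at h
    refine h.congr' ?_
    filter_upwards [hn'.eventually_ge_atTop r] with i hi
    have hc : (((n i).choose (r + 1) : ℝ)) * (r + 1) = (n i).choose r * (n i - r) := by
      have := Nat.choose_succ_right_eq (n i) r
      rw [← Nat.cast_sub hi]
      exact_mod_cast this
    rw [div_eq_iff (by positivity), pow_succ]
    linear_combination (-(p i ^ r * p i)) * hc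

namespace SimpleGraph

/-- The parameters of sparse random bipartite graphs: the mean degrees in the two classes converge
to `b` and `a`. -/
structure SparseRegime (n m : ℕ → ℕ) (p : ℕ → ℝ) (a b : ℝ) : Prop where
  nonneg : ∀ i, 0 ≤ p i
  le_one : ∀ i, p i ≤ 1
  tendsto_p : Tendsto p atTop (𝓝 0)
  tendsto_left : Tendsto (fun i => p i * n i) atTop (𝓝 a)
  tendsto_right : Tendsto (fun i => p i * m i) atTop (𝓝 b)
  left_atTop : Tendsto n atTop atTop
  right_atTop : Tendsto m atTop atTop

/-- Random graphs serve as a tool for analysis: statements about `treeSum` that mention no graph are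
proved along some regime with limits `a` and `b`. -/
theorem exists_sparseRegime {a b : ℝ} (ha : 0 < a) (hb : 0 < b) :
    ∃ n m p, SparseRegime n m p a b := by
  have hinv : Tendsto (fun i : ℕ => 1 / ((i : ℝ) + 1)) atTop (𝓝 0) :=
    tendsto_one_div_add_atTop_nhds_zero_nat
  have hat : Tendsto (fun i : ℕ => (i : ℝ) + 1) atTop atTop :=
    tendsto_atTop_add_const_right _ _ tendsto_natCast_atTop_atTop
  have hl : ∀ {c : ℝ}, 0 < c →
      Tendsto (fun i : ℕ => 1 / ((i : ℝ) + 1) * (⌊c * ((i : ℝ) + 1)⌋₊ : ℝ)) atTop (𝓝 c) := by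
    intro c hc
    refine ((tendsto_nat_floor_mul_div_atTop hc.le).comp hat).congr fun i => ?_
    rw [Function.comp_apply]
    ring
  have hr : ∀ {c : ℝ}, 0 < c → Tendsto (fun i : ℕ => ⌊c * ((i : ℝ) + 1)⌋₊) atTop atTop := by
    intro c hc
    exact tendsto_nat_floor_atTop.comp (hat.const_mul_atTop hc)
  refine ⟨fun i => ⌊a * ((i : ℝ) + 1)⌋₊, fun i => ⌊b * ((i : ℝ) + 1)⌋₊,
    fun i => 1 / ((i : ℝ) + 1), fun i => by positivity, fun i => ?_, hinv, hl ha, hl hb, hr ha,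
    hr hb⟩
  rw [div_le_one (by positivity)]
  linarith [Nat.cast_nonneg (α := ℝ) i]

/-- The terms of degree `k` of the exponential generating function of bipartite trees. -/
noncomputable def treePoly (x y : ℝ) (k : ℕ) : ℝ :=
  ∑ q ∈ Finset.HasAntidiagonal.antidiagonal k,
    (numTrees q.1 q.2 : ℝ) / ((q.1.factorial : ℝ) * q.2.factorial) * (x ^ q.1 * y ^ q.2)

/-- The exponential generating function of bipartite trees. -/
noncomputable def treeSum (x y : ℝ) : ℝ := ∑' k, treePoly x y (k + 1)

theorem treePoly_nonneg {x y : ℝ} (hx : 0 ≤ x) (hy : 0 ≤ y) (k : ℕ) : 0 ≤ treePoly x y k :=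
  Finset.sum_nonneg fun q _ => by positivity

/-- The expectation for the random bipartite graph with `n` and `m` vertices. -/
noncomputable abbrev graphExp (p : ℝ) (n m : ℕ) (f : Finset (Fin n × Fin m) → ℝ) : ℝ :=
  bernoulliExp p Finset.univ f

namespace SparseRegime

variable {n m : ℕ → ℕ} {p : ℕ → ℝ} {a b : ℝ} (h : SparseRegime n m p a b)

include h

/-- The powers of `p` combine with the binomial coefficients to `a ^ r b ^ s / (r! s!)`, leaving `p
^ (|U| + 1 - r - s)`, which survives only when `U` is a tree. The roughly `r m + s n` absent edges
contribute `exp (-(r b + s a))`. -/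
theorem tendsto_compCount (r s : ℕ) :
    Tendsto (fun i => p i * graphExp (p i) (n i) (m i) (fun S => (compCount S r s : ℝ))) atTop
      (𝓝 ((numTrees r s : ℝ) / ((r.factorial : ℝ) * s.factorial) *
        ((a * Real.exp (-b)) ^ r * (b * Real.exp (-a)) ^ s))) := by
  have hU : ∀ U ∈ connSets r s, Tendsto (fun i => p i ^ (U.card + 1 - (r + s)) *
      (1 - p i) ^ (n i * m i - (n i - r) * (m i - s) - U.card)) atTop
      (𝓝 (if U.card + 1 = r + s then Real.exp (-(r * b + s * a)) else 0)) := by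
    intro U hU
    -- A connected graph has at least `r + s - 1` edges, so the subtraction in the exponent does not
    -- truncate.
    have hle := le_card_add_one_of_mem_connSets hU
    have hUc : U.card ≤ r * s := by simpa using Finset.card_le_univ U
    have hexp : Tendsto (fun i => p i * (((n i * m i - (n i - r) * (m i - s) - U.card : ℕ)) : ℝ))
        atTop (𝓝 (r * b + s * a)) := by
      have h1 := ((h.tendsto_right.const_mul (r : ℝ)).add (h.tendsto_left.const_mul (s : ℝ))).sub
        (h.tendsto_p.mul_const ((r : ℝ) * s + U.card))
      rw [zero_mul, sub_zero] at h1
      refine h1.congr' ?_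
      filter_upwards [h.left_atTop.eventually_ge_atTop r, h.right_atTop.eventually_ge_atTop s]
        with i hi hj
      have hcast : (((n i * m i - (n i - r) * (m i - s) - U.card : ℕ)) : ℝ) =
          r * m i + s * n i - r * s - U.card := by
        obtain ⟨n', hn'⟩ := Nat.exists_eq_add_of_le hi
        obtain ⟨m', hm'⟩ := Nat.exists_eq_add_of_le hj
        rw [hn', hm', Nat.add_sub_cancel_left, Nat.add_sub_cancel_left,
          show (r + n') * (s + m') = n' * m' + (r * s + r * m' + s * n') by ring,
          Nat.add_sub_cancel_left, Nat.cast_sub (by omega)]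
        push_cast
        ring
      rw [hcast]
      ring
    have h2 := tendsto_one_sub_pow h.tendsto_p hexp
    split_ifs with hc
    · simpa [hc] using h2
    · have h3 : Tendsto (fun i => p i ^ (U.card + 1 - (r + s))) atTop (𝓝 0) := by
        have := h.tendsto_p.pow (U.card + 1 - (r + s))
        rwa [zero_pow (by omega)] at this
      simpa using h3.mul h2
  have hsum := tendsto_finsetSum (connSets r s) hU
  have hlim : ∑ U ∈ connSets r s,
      (if U.card + 1 = r + s then Real.exp (-(r * b + s * a)) else 0) =
      numTrees r s * Real.exp (-(r * b + s * a)) := by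
    rw [← Finset.sum_filter, Finset.sum_const, nsmul_eq_mul, numTrees]
  rw [hlim] at hsum
  have hall := ((tendsto_choose_mul_pow h.tendsto_p h.tendsto_left h.left_atTop r).mul
    (tendsto_choose_mul_pow h.tendsto_p h.tendsto_right h.right_atTop s)).mul hsum
  have hval : a ^ r / (r.factorial : ℝ) * (b ^ s / s.factorial) *
      (numTrees r s * Real.exp (-(r * b + s * a))) =
      (numTrees r s : ℝ) / ((r.factorial : ℝ) * s.factorial) *
        ((a * Real.exp (-b)) ^ r * (b * Real.exp (-a)) ^ s) := by
    rw [mul_pow, mul_pow, ← Real.exp_nat_mul, ← Real.exp_nat_mul,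
      show -((r : ℝ) * b + s * a) = r * -b + s * -a by ring, Real.exp_add]
    field_simp
  rw [hval] at hall
  refine hall.congr fun i => ?_
  rw [graphExp, bernoulliExp_compCount, Fintype.card_fin, Fintype.card_fin]
  simp only [Finset.mul_sum]
  refine Finset.sum_congr rfl fun U hU => ?_
  have hle := le_card_add_one_of_mem_connSets hU
  have hpow : p i * p i ^ U.card = p i ^ r * p i ^ s * p i ^ (U.card + 1 - (r + s)) := by
    rw [← pow_add, ← pow_add, ← pow_succ']
    congr 1
    omega
  linear_combination (-(((n i).choose r : ℝ) * (m i).choose s *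
    (1 - p i) ^ (n i * m i - (n i - r) * (m i - s) - U.card))) * hpow

theorem tendsto_sum_compCount (K : ℕ) :
    Tendsto (fun i => p i * graphExp (p i) (n i) (m i) (fun S => ∑ k ∈ Finset.range K,
      ∑ q ∈ Finset.HasAntidiagonal.antidiagonal (k + 1), (compCount S q.1 q.2 : ℝ))) atTop
      (𝓝 (∑ k ∈ Finset.range K,
        treePoly (a * Real.exp (-b)) (b * Real.exp (-a)) (k + 1))) := by
  simp only [graphExp, bernoulliExp_sum, Finset.mul_sum, treePoly]
  exact tendsto_finsetSum _ fun k _ => tendsto_finsetSum _ fun q _ => h.tendsto_compCount q.1 q.2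

theorem tendsto_card : Tendsto (fun i => p i * ((n i : ℝ) + m i)) atTop (𝓝 (a + b)) :=
  (h.tendsto_left.add h.tendsto_right).congr fun i => by ring

/-- There are never more components than vertices. In the limit this bounds the partial sums, and
the series converges because its terms are nonnegative. -/
theorem sum_treePoly_le (K : ℕ) :
    ∑ k ∈ Finset.range K, treePoly (a * Real.exp (-b)) (b * Real.exp (-a)) (k + 1) ≤ a + b := by
  refine le_of_tendsto_of_tendsto' (h.tendsto_sum_compCount K) h.tendsto_card fun i => ?_
  refine mul_le_mul_of_nonneg_left ?_ (h.nonneg i)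
  refine (bernoulliExp_mono (h.nonneg i) (h.le_one i) (g := fun _ => (n i : ℝ) + m i)
    fun S _ => ?_).trans (le_of_eq (bernoulliExp_const _))
  have h1 := sum_compCount_le S K
  have h2 : Nat.card (bip S).ConnectedComponent ≤ n i + m i := by
    have := Nat.card_le_card_of_surjective (bip S).connectedComponentMk Quot.mk_surjective
    simpa using this
  exact_mod_cast h1.trans h2

/-- Components with at most `K` vertices converge term by term; the larger ones contribute at most
`p (n + m) / (K + 1)`, which is small uniformly in `i` once `K` is large. -/
theorem tendsto_card_connectedComponent (ha : 0 < a) (hb : 0 < b) :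
    Tendsto (fun i => p i * graphExp (p i) (n i) (m i)
      (fun S => (Nat.card (bip S).ConnectedComponent : ℝ))) atTop
      (𝓝 (treeSum (a * Real.exp (-b)) (b * Real.exp (-a)))) := by
  have hnn := treePoly_nonneg (x := a * Real.exp (-b)) (y := b * Real.exp (-a)) (by positivity)
    (by positivity)
  have hs : Summable fun k => treePoly (a * Real.exp (-b)) (b * Real.exp (-a)) (k + 1) :=
    summable_of_sum_range_le (fun k => hnn _) h.sum_treePoly_le
  have hpart := hs.hasSum.tendsto_sum_nat
  have htail : Tendsto (fun K : ℕ => (a + b + 1) / ((K : ℝ) + 1)) atTop (𝓝 0) := by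
    have := (tendsto_one_div_add_atTop_nhds_zero_nat (𝕜 := ℝ)).const_mul (a + b + 1)
    simpa [div_eq_mul_inv] using this
  rw [Metric.tendsto_atTop]
  intro ε hε
  have e1 : ∀ᶠ K : ℕ in atTop, |∑ k ∈ Finset.range K,
      treePoly (a * Real.exp (-b)) (b * Real.exp (-a)) (k + 1) -
        treeSum (a * Real.exp (-b)) (b * Real.exp (-a))| < ε / 3 :=
    (Metric.tendsto_nhds.1 hpart _ (by positivity))
  have e2 : ∀ᶠ K : ℕ in atTop, (a + b + 1) / ((K : ℝ) + 1) < ε / 3 :=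
    htail.eventually (gt_mem_nhds (by positivity))
  obtain ⟨K, hK1, hK2⟩ := (e1.and e2).exists
  have e3 := Metric.tendsto_nhds.1 (h.tendsto_sum_compCount K) (ε / 3) (by positivity)
  have e4 := h.tendsto_card.eventually (gt_mem_nhds (show a + b < a + b + 1 by linarith))
  obtain ⟨N, hN⟩ := eventually_atTop.1 (e3.and e4)
  refine ⟨N, fun i hi => ?_⟩
  obtain ⟨h3, h4⟩ := hN i hi
  set A := graphExp (p i) (n i) (m i) (fun S => ∑ k ∈ Finset.range K,
      ∑ q ∈ Finset.HasAntidiagonal.antidiagonal (k + 1), (compCount S q.1 q.2 : ℝ)) with hA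
  set B := graphExp (p i) (n i) (m i) (fun S => (Nat.card (bip S).ConnectedComponent : ℝ)) with hB
  have hAB : A ≤ B := bernoulliExp_mono (h.nonneg i) (h.le_one i) fun S _ => by
    exact_mod_cast sum_compCount_le S K
  have hBA : B ≤ A + ((n i : ℝ) + m i) / (K + 1) := by
    rw [hA, hB, graphExp, graphExp, ← bernoulliExp_const (p := p i)
      (E := (Finset.univ : Finset (Fin (n i) × Fin (m i)))) (((n i : ℝ) + m i) / (K + 1)),
      ← bernoulliExp_add]
    refine bernoulliExp_mono (h.nonneg i) (h.le_one i) fun S _ => ?_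
    simpa using card_connectedComponent_le_sum_compCount S K
  have hpAB := mul_le_mul_of_nonneg_left hAB (h.nonneg i)
  have hpBA := mul_le_mul_of_nonneg_left hBA (h.nonneg i)
  have h5 : p i * (((n i : ℝ) + m i) / (K + 1)) < ε / 3 := by
    refine lt_of_le_of_lt ?_ hK2
    rw [← mul_div_assoc]
    gcongr
  rw [Real.dist_eq] at h3 ⊢
  rw [abs_lt] at h3 hK1 ⊢
  constructor <;> linarith

theorem tendsto_cyclomatic (ha : 0 < a) (hb : 0 < b) :
    Tendsto (fun i => p i * graphExp (p i) (n i) (m i)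
      (fun S => ((bip S).cyclomatic : ℝ))) atTop
      (𝓝 (a * b - (a + b) + treeSum (a * Real.exp (-b)) (b * Real.exp (-a)))) := by
  have h1 := ((h.tendsto_left.mul h.tendsto_right).sub h.tendsto_card).add
    (h.tendsto_card_connectedComponent ha hb)
  refine h1.congr fun i => ?_
  have h2 : (fun S : Finset (Fin (n i) × Fin (m i)) => ((bip S).cyclomatic : ℝ)) =
      fun S => ((S.card : ℝ) - (n i + m i)) + Nat.card (bip S).ConnectedComponent := by
    ext S
    rw [cyclomatic, card_edgeSet_bip]
    simp
  rw [h2, graphExp, graphExp, bernoulliExp_add, bernoulliExp_sub, bernoulliExp_const,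
    bernoulliExp_card]
  simp
  ring

theorem tendsto_sq : Tendsto (fun i => (n i : ℝ) * m i * p i ^ 2) atTop (𝓝 (a * b)) :=
  (h.tendsto_left.mul h.tendsto_right).congr fun i => by ring

/-- Since `n m p ^ 2` converges, the expected number of short edges stays bounded for fixed `L`, and
the factor `p` sends it to zero. -/
theorem tendsto_shortEdges (L : ℕ) :
    Tendsto (fun i => p i * graphExp (p i) (n i) (m i)
      (fun S => ((shortEdges S L).card : ℝ))) atTop (𝓝 0) := by
  have h1 : Tendsto (fun i => p i * ∑ k ∈ Finset.range (L + 1),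
      ((n i : ℝ) * m i * p i ^ 2) ^ (k + 1)) atTop
      (𝓝 (0 * ∑ k ∈ Finset.range (L + 1), (a * b) ^ (k + 1))) :=
    h.tendsto_p.mul (tendsto_finsetSum _ fun k _ => h.tendsto_sq.pow (k + 1))
  rw [zero_mul] at h1
  refine squeeze_zero (fun i => mul_nonneg (h.nonneg i) ?_)
    (fun i => mul_le_mul_of_nonneg_left ?_ (h.nonneg i)) h1
  · rw [graphExp, ← bernoulliExp_const (p := p i)
      (E := (Finset.univ : Finset (Fin (n i) × Fin (m i)))) 0]
    exact bernoulliExp_mono (h.nonneg i) (h.le_one i) fun S _ => by positivity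
  · simpa using bernoulliExp_card_shortEdges_le (α := Fin (n i)) (β := Fin (m i))
      (h.nonneg i) (h.le_one i) L

/-- In the subcritical range the cyclomatic number is bounded by the edges on cycles of any length,
whose expectation is eventually below a geometric series of ratio `D < 1`. Multiplied by `p` it
vanishes, so the limit in `tendsto_cyclomatic` must be zero. -/
theorem treeSum_eq (ha : 0 < a) (hb : 0 < b) (hab : a * b < 1) :
    treeSum (a * Real.exp (-b)) (b * Real.exp (-a)) = a + b - a * b := by
  have h1 := h.tendsto_cyclomatic ha hb
  obtain ⟨D, hD1, hD2⟩ := exists_between hab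
  have hD0 : 0 < D := (mul_pos ha hb).trans hD1
  have h0 : Tendsto (fun i => p i * (D / (1 - D))) atTop (𝓝 0) := by
    simpa using h.tendsto_p.mul_const (D / (1 - D))
  have hz : Tendsto (fun i => p i * graphExp (p i) (n i) (m i)
      (fun S => ((bip S).cyclomatic : ℝ))) atTop (𝓝 0) := by
    refine squeeze_zero' (Eventually.of_forall fun i => mul_nonneg (h.nonneg i) ?_) ?_ h0
    · rw [graphExp, ← bernoulliExp_const (p := p i)
        (E := (Finset.univ : Finset (Fin (n i) × Fin (m i)))) 0]
      exact bernoulliExp_mono (h.nonneg i) (h.le_one i) fun S _ => by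
        exact_mod_cast cyclomatic_bip_nonneg S
    · filter_upwards [h.tendsto_sq.eventually (gt_mem_nhds hD1)] with i hi
      refine mul_le_mul_of_nonneg_left ?_ (h.nonneg i)
      have e1 : graphExp (p i) (n i) (m i) (fun S => ((bip S).cyclomatic : ℝ)) ≤
          graphExp (p i) (n i) (m i) (fun S =>
            ((shortEdges S (Fintype.card (Fin (n i) ⊕ Fin (m i)))).card : ℝ)) :=
        bernoulliExp_mono (h.nonneg i) (h.le_one i) fun S _ => by
          exact_mod_cast cyclomatic_bip_le S
      refine (e1.trans (bernoulliExp_card_shortEdges_le (h.nonneg i) (h.le_one i) _)).trans ?_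
      simp only [Fintype.card_fin]
      set q := (n i : ℝ) * m i * p i ^ 2
      have hq0 : 0 ≤ q := by have := h.nonneg i; positivity
      calc ∑ k ∈ Finset.range (Fintype.card (Fin (n i) ⊕ Fin (m i)) + 1), q ^ (k + 1)
          ≤ ∑ k ∈ Finset.range (Fintype.card (Fin (n i) ⊕ Fin (m i)) + 1), D * D ^ k := by
            refine Finset.sum_le_sum fun k _ => ?_
            rw [← pow_succ']
            exact pow_le_pow_left₀ hq0 hi.le _
        _ ≤ ∑' k, D * D ^ k :=
            ((summable_geometric_of_lt_one hD0.le hD2).mul_left D).sum_le_tsum _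
              fun k _ => by positivity
        _ = D / (1 - D) := by
            rw [tsum_mul_left, tsum_geometric_of_lt_one hD0.le hD2, div_eq_mul_inv]
  linarith [tendsto_nhds_unique h1 hz]

end SparseRegime

theorem summable_treePoly {a b : ℝ} (ha : 0 < a) (hb : 0 < b) :
    Summable fun k => treePoly (a * Real.exp (-b)) (b * Real.exp (-a)) (k + 1) := by
  obtain ⟨n, m, p, h⟩ := exists_sparseRegime ha hb
  exact summable_of_sum_range_le
    (fun k => treePoly_nonneg (by positivity) (by positivity) _) h.sum_treePoly_le

theorem treeSum_eq {a b : ℝ} (ha : 0 < a) (hb : 0 < b) (hab : a * b < 1) :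
    treeSum (a * Real.exp (-b)) (b * Real.exp (-a)) = a + b - a * b := by
  obtain ⟨n, m, p, h⟩ := exists_sparseRegime ha hb
  exact h.treeSum_eq ha hb hab

end SimpleGraph

/-! ### Comparing coefficients: from the subcritical identity to Scoins' formula. -/

theorem eq_zero_of_tsum_mul_pow_eq_zero {c : ℕ → ℝ} {δ : ℝ} (hδ : 0 < δ)
    (hc : Summable fun k => |c k| * δ ^ k)
    (h : ∀ a, 0 < a → a ≤ δ → ∑' k, c k * a ^ k = 0) (m : ℕ) : c m = 0 := by
  induction m using Nat.strong_induction_on with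
  | _ m ih =>
    have hs : ∀ a, 0 < a → a ≤ δ → Summable fun k => c k * a ^ k := fun a ha haδ => by
      refine Summable.of_norm_bounded (g := fun k => |c k| * δ ^ k) hc fun k => ?_
      rw [Real.norm_eq_abs, abs_mul, abs_of_nonneg (pow_nonneg ha.le k)]
      exact mul_le_mul_of_nonneg_left (pow_le_pow_left₀ ha.le haδ k) (abs_nonneg _)
    have hM : Summable fun k => |c (k + (m + 1))| * δ ^ (k + (m + 1)) :=
      (summable_nat_add_iff (f := fun k => |c k| * δ ^ k) (m + 1)).2 hc
    set M := ∑' k, |c (k + (m + 1))| * δ ^ (k + (m + 1)) with hMdef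
    have hM0 : 0 ≤ M := tsum_nonneg fun k => by positivity
    -- The earlier coefficients vanish, so `c m * a ^ m` is minus a tail of order `a ^ (m + 1)`.
    -- Dividing by `a ^ m` and letting `a` decrease to zero leaves `c m = 0`.
    have key : ∀ a, 0 < a → a ≤ δ → |c m| ≤ a * (M / δ ^ (m + 1)) := by
      intro a ha haδ
      have h1 := (hs a ha haδ).sum_add_tsum_nat_add (m + 1)
      rw [h a ha haδ, Finset.sum_range_succ, Finset.sum_eq_zero fun k hk => by
        rw [ih k (Finset.mem_range.1 hk), zero_mul], zero_add] at h1
      have h2 : |∑' k, c (k + (m + 1)) * a ^ (k + (m + 1))| ≤ (a / δ) ^ (m + 1) * M := by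
        rw [← Real.norm_eq_abs, hMdef, ← tsum_mul_left]
        refine tsum_of_norm_bounded (hM.mul_left _).hasSum fun k => ?_
        rw [norm_mul, Real.norm_eq_abs, Real.norm_eq_abs, abs_of_nonneg (pow_nonneg ha.le _),
          div_pow, pow_add a k, pow_add δ k]
        have : a ^ k ≤ δ ^ k := pow_le_pow_left₀ ha.le haδ k
        calc |c (k + (m + 1))| * (a ^ k * a ^ (m + 1))
            ≤ |c (k + (m + 1))| * (δ ^ k * a ^ (m + 1)) := by gcongr
          _ = _ := by field_simp
      have h3 : |c m| * a ^ m ≤ (a / δ) ^ (m + 1) * M := by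
        have : c m * a ^ m = -∑' k, c (k + (m + 1)) * a ^ (k + (m + 1)) := by linarith
        rw [← abs_neg, ← this, abs_mul, abs_of_nonneg (pow_nonneg ha.le m)] at h2
        exact h2
      rw [← mul_le_mul_iff_left₀ (pow_pos ha m)]
      refine h3.trans (le_of_eq ?_)
      rw [div_pow, pow_succ a]
      field_simp
    have hlim : Tendsto (fun a : ℝ => a * (M / δ ^ (m + 1))) (𝓝[>] 0)
        (𝓝 (0 * (M / δ ^ (m + 1)))) :=
      ((continuous_id.mul continuous_const).tendsto 0).mono_left nhdsWithin_le_nhds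
    rw [zero_mul] at hlim
    have hle : |c m| ≤ 0 := by
      refine ge_of_tendsto hlim ?_
      filter_upwards [Ioc_mem_nhdsGT hδ] with a ha using key a ha.1 ha.2
    exact abs_nonpos_iff.1 hle

/-- The coefficients of a power series, collected from an absolutely convergent double series, whose
sum is an affine function. -/
theorem sum_antidiagonal_eq_of_tsum_eq {f : ℕ × ℕ → ℝ} {δ P Q : ℝ} (hδ : 0 < δ)
    (hf : Summable fun q => |f q| * δ ^ (q.1 + q.2))
    (h : ∀ a, 0 < a → a ≤ δ → ∑' q, f q * a ^ (q.1 + q.2) = P + Q * a) (m : ℕ) :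
    ∑ q ∈ Finset.HasAntidiagonal.antidiagonal m, f q =
      if m = 0 then P else if m = 1 then Q else 0 := by
  have hanti : ∀ (g : ℕ × ℕ → ℝ) (a : ℝ) (k : ℕ),
      ∑' q : Finset.HasAntidiagonal.antidiagonal k, g q * a ^ (q.1.1 + q.1.2) =
        (∑ q ∈ Finset.HasAntidiagonal.antidiagonal k, g q) * a ^ k := by
    intro g a k
    rw [Finset.tsum_subtype _ (fun q : ℕ × ℕ => g q * a ^ (q.1 + q.2)), Finset.sum_mul]
    refine Finset.sum_congr rfl fun q hq => ?_
    rw [Finset.HasAntidiagonal.mem_antidiagonal.1 hq]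
  let c : ℕ → ℝ := fun k => ∑ q ∈ Finset.HasAntidiagonal.antidiagonal k, f q
  let e : ℕ → ℝ := fun k => if k = 0 then P else if k = 1 then Q else 0
  have he : ∀ a : ℝ, HasSum (fun k => e k * a ^ k) (P + Q * a) := by
    intro a
    have : HasSum (fun k => e k * a ^ k) (∑ k ∈ Finset.range 2, e k * a ^ k) :=
      hasSum_sum_of_ne_finset_zero (fun k hk => by
        rw [Finset.mem_range, not_lt] at hk
        simp [e, show k ≠ 0 by omega, show k ≠ 1 by omega])
    simpa [Finset.sum_range_succ, e] using this
  have habs : Summable fun k => |c k| * δ ^ k := by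
    have h1 := (Finset.HasAntidiagonal.sigmaAntidiagonalEquivProd.summable_iff.2 hf).sigma
    refine h1.of_nonneg_of_le (fun k => by positivity) fun k => ?_
    refine le_of_le_of_eq ?_ (hanti (fun q => |f q|) δ k).symm
    gcongr
    exact Finset.abs_sum_le_sum_abs _ _
  have hsum : ∀ a, 0 < a → a ≤ δ → HasSum (fun k => c k * a ^ k) (P + Q * a) := by
    intro a ha haδ
    have hs : Summable fun q : ℕ × ℕ => f q * a ^ (q.1 + q.2) := by
      refine Summable.of_norm_bounded (g := fun q => |f q| * δ ^ (q.1 + q.2)) hf fun q => ?_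
      rw [norm_mul, Real.norm_eq_abs, Real.norm_eq_abs, abs_of_nonneg (pow_nonneg ha.le _)]
      gcongr
    have h1 := (Finset.HasAntidiagonal.sigmaAntidiagonalEquivProd (A := ℕ)).hasSum_iff.2 (h a ha haδ ▸ hs.hasSum)
    refine h1.sigma (g := fun k => c k * a ^ k) fun k => ?_
    rw [← hanti f a k]
    exact (Summable.of_finite (f := fun q : Finset.HasAntidiagonal.antidiagonal k =>
      f q * a ^ (q.1.1 + q.1.2))).hasSum
  have hz := eq_zero_of_tsum_mul_pow_eq_zero (c := fun k => c k - e k) hδ ?_ ?_ m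
  · exact sub_eq_zero.1 hz
  · have heabs : Summable fun k => |e k| * δ ^ k := by
      refine summable_of_ne_finset_zero (s := Finset.range 2) fun k hk => ?_
      rw [Finset.mem_range, not_lt] at hk
      simp [e, show k ≠ 0 by omega, show k ≠ 1 by omega]
    refine (habs.add heabs).of_nonneg_of_le (fun k => by positivity) fun k => ?_
    rw [← add_mul]
    gcongr
    exact abs_sub _ _
  · intro a ha haδ
    have := (hsum a ha haδ).sub (he a)
    simp only [← sub_mul, sub_self] at this
    exact this.tsum_eq

/-- `r ^ (s - 1) * s ^ (r - 1) / (r! s!)`, the normalized number of spanning trees of the complete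
bipartite graph. -/
noncomputable def scoinsCoeff (r s : ℕ) : ℝ :=
  (r : ℝ) ^ ((s : ℤ) - 1) * (s : ℝ) ^ ((r : ℤ) - 1) / ((r.factorial : ℝ) * (s.factorial : ℝ))

theorem scoinsCoeff_comm (r s : ℕ) : scoinsCoeff r s = scoinsCoeff s r := by
  unfold scoinsCoeff
  rw [mul_comm ((r : ℝ) ^ _), mul_comm (r.factorial : ℝ)]

theorem scoinsCoeff_zero_left (s : ℕ) : scoinsCoeff 0 s = if s = 1 then 1 else 0 := by
  unfold scoinsCoeff
  split_ifs with h
  · simp [h]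
  -- For `s = 0` the exponent is `-1`, and the convention `0⁻¹ = 0` makes the coefficient vanish.
  · have : (s : ℤ) - 1 ≠ 0 := by omega
    simp [zero_zpow _ this]

/-- Coefficients of `∑ u (r, s) (a exp (-b)) ^ r (b exp (-a)) ^ s` in powers of `a` and `b`. -/
noncomputable def twistCoeff (u : ℕ → ℕ → ℝ) (m n : ℕ) : ℝ :=
  ∑ q ∈ Finset.HasAntidiagonal.antidiagonal n, ∑ x ∈ Finset.HasAntidiagonal.antidiagonal m,
    u x.1 q.1 * ((-(q.1 : ℝ)) ^ x.2 / x.2.factorial * ((-(x.1 : ℝ)) ^ q.2 / q.2.factorial))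

/-- Up to the factor `1 / m!` this is the `m`-th finite difference of `x ^ k` at zero. -/
theorem sum_antidiagonal_alternating_pow {m k : ℕ} (hkm : k < m) :
    ∑ x ∈ Finset.HasAntidiagonal.antidiagonal m,
      (-1 : ℝ) ^ x.2 * (x.1 : ℝ) ^ k / ((x.1.factorial : ℝ) * x.2.factorial) = 0 := by
  have h := congrFun (fwdDiff_iter_pow_eq_zero_of_lt (R := ℝ) hkm) 0
  rw [fwdDiff_iter_eq_sum_shift] at h
  rw [Finset.Nat.sum_antidiagonal_eq_sum_range_succ (fun r i =>
    (-1 : ℝ) ^ i * (r : ℝ) ^ k / ((r.factorial : ℝ) * i.factorial))]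
  have h2 : ∑ r ∈ Finset.range m.succ,
      (-1 : ℝ) ^ (m - r) * (r : ℝ) ^ k / ((r.factorial : ℝ) * (m - r).factorial) =
      (∑ r ∈ Finset.range (m + 1), ((-1 : ℤ) ^ (m - r) * (m.choose r : ℤ)) •
        ((0 : ℝ) + r • (1 : ℝ)) ^ k) / m.factorial := by
    rw [Finset.sum_div]
    refine Finset.sum_congr rfl fun r hr => ?_
    have hr' : r ≤ m := Nat.lt_succ_iff.1 (Finset.mem_range.1 hr)
    have hch : (m.choose r : ℝ) = m.factorial / (r.factorial * (m - r).factorial) :=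
      Nat.cast_choose ℝ hr'
    simp only [zsmul_eq_mul, nsmul_eq_mul, mul_one, zero_add]
    push_cast
    rw [hch]
    field_simp
  rw [h2, h]
  simp

theorem twistCoeff_scoinsCoeff_zero_left (n : ℕ) :
    twistCoeff scoinsCoeff 0 n = if n = 1 then 1 else 0 := by
  unfold twistCoeff
  rw [Finset.sum_eq_single_of_mem (n, 0) (by simp)]
  · simp [scoinsCoeff_zero_left]
  · rintro ⟨s, j⟩ h1 h2
    rw [Finset.HasAntidiagonal.mem_antidiagonal] at h1
    have : j ≠ 0 := by rintro rfl; exact h2 (by simpa using h1)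
    simp [this]

theorem twistCoeff_comm (m n : ℕ) : twistCoeff scoinsCoeff m n = twistCoeff scoinsCoeff n m := by
  unfold twistCoeff
  rw [Finset.sum_comm]
  refine Finset.sum_congr rfl fun x _ => Finset.sum_congr rfl fun q _ => ?_
  rw [scoinsCoeff_comm, mul_comm (_ / _)]

/-- For `m, n ≥ 1` the powers merge: `s ^ (r - 1) s ^ i = s ^ (m - 1)` and `r ^ (s - 1) r ^ j = r ^
(n - 1)`. The double sum becomes a product of two alternating sums, one of which vanishes because `n
- 1 < m` or `m - 1 < n`. -/
theorem twistCoeff_scoinsCoeff (m n : ℕ) : twistCoeff scoinsCoeff m n =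
    if m = 0 then (if n = 1 then 1 else 0) else
      if m = 1 then (if n = 0 then 1 else if n = 1 then -1 else 0) else 0 := by
  rcases Nat.eq_zero_or_pos m with rfl | hm
  · simpa using twistCoeff_scoinsCoeff_zero_left n
  rcases Nat.eq_zero_or_pos n with rfl | hn
  · rw [twistCoeff_comm, twistCoeff_scoinsCoeff_zero_left]
    simp [hm.ne']
  -- Here the factorization fails: at `r = s = 0` the merged powers are `0 ^ 0 = 1`, whereas
  -- `scoinsCoeff 0 0 = 0`. This produces the coefficient `-1`.
  by_cases h11 : m = 1 ∧ n = 1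
  · obtain ⟨rfl, rfl⟩ := h11
    simp [twistCoeff, scoinsCoeff, Finset.Nat.antidiagonal_succ]
  have hR : (if m = 0 then (if n = 1 then (1 : ℝ) else 0) else
      if m = 1 then (if n = 0 then 1 else if n = 1 then -1 else 0) else 0) = 0 := by
    split_ifs <;> first | omega | rfl
  rw [hR]
  have hterm : ∀ q ∈ Finset.HasAntidiagonal.antidiagonal n,
      ∀ x ∈ Finset.HasAntidiagonal.antidiagonal m,
      scoinsCoeff x.1 q.1 *
        ((-(q.1 : ℝ)) ^ x.2 / x.2.factorial * ((-(x.1 : ℝ)) ^ q.2 / q.2.factorial)) =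
      ((-1 : ℝ) ^ q.2 * (q.1 : ℝ) ^ (m - 1) / ((q.1.factorial : ℝ) * q.2.factorial)) *
      ((-1 : ℝ) ^ x.2 * (x.1 : ℝ) ^ (n - 1) / ((x.1.factorial : ℝ) * x.2.factorial)) := by
    rintro ⟨s, j⟩ hq ⟨r, i⟩ hx
    rw [Finset.HasAntidiagonal.mem_antidiagonal] at hq hx
    simp only at hq hx ⊢
    subst hq hx
    rcases Nat.eq_zero_or_pos r with rfl | hr
    · rw [scoinsCoeff_zero_left]
      by_cases hs : s = 1
      · subst hs
        rcases Nat.eq_zero_or_pos j with rfl | hj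
        · simp
        · simp [hj.ne']
      · rcases Nat.eq_zero_or_pos s with rfl | hs0
        · by_cases hj : j = 1
          · simp [hj, zero_pow (show i - 1 ≠ 0 by omega)]
          · simp [zero_pow (show j - 1 ≠ 0 by omega)]
        · simp [hs, zero_pow (show s + j - 1 ≠ 0 by omega)]
    · rcases Nat.eq_zero_or_pos s with rfl | hs
      · rw [scoinsCoeff_comm, scoinsCoeff_zero_left]
        by_cases hr1 : r = 1
        · subst hr1
          rcases Nat.eq_zero_or_pos i with rfl | hi
          · simp
          · simp [hi.ne']
        · simp [hr1, zero_pow (show r + i - 1 ≠ 0 by omega)]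
      · unfold scoinsCoeff
        obtain ⟨r, rfl⟩ := Nat.exists_eq_add_of_le' hr
        obtain ⟨s, rfl⟩ := Nat.exists_eq_add_of_le' hs
        rw [show ((s + 1 : ℕ) : ℤ) - 1 = (s : ℕ) by push_cast; ring,
          show ((r + 1 : ℕ) : ℤ) - 1 = (r : ℕ) by push_cast; ring, zpow_natCast, zpow_natCast,
          show s + 1 + j - 1 = s + j by omega, show r + 1 + i - 1 = r + i by omega,
          neg_pow ((s + 1 : ℕ) : ℝ), neg_pow ((r + 1 : ℕ) : ℝ), pow_add, pow_add]
        field_simp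
  unfold twistCoeff
  rw [Finset.sum_congr rfl fun q hq => Finset.sum_congr rfl fun x hx => hterm q hq x hx,
    ← Finset.sum_mul_sum]
  rcases lt_or_ge (n - 1) m with h | h
  · rw [sum_antidiagonal_alternating_pow h, mul_zero]
  · rw [sum_antidiagonal_alternating_pow (show m - 1 < n by omega), zero_mul]

/-- The transformation is triangular: the coefficient at `(m, n)` is `u m n` plus a combination of
values with smaller index sum. -/
theorem eq_of_twistCoeff_eq {u v : ℕ → ℕ → ℝ}
    (h : ∀ m n, twistCoeff u m n = twistCoeff v m n) (m n : ℕ) : u m n = v m n := by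
  induction hk : m + n using Nat.strong_induction_on generalizing m n with
  | _ k ih =>
    subst hk
    have h1 : twistCoeff (fun r s => u r s - v r s) m n = 0 := by
      have := sub_eq_zero.2 (h m n)
      unfold twistCoeff at this ⊢
      rw [← this, ← Finset.sum_sub_distrib]
      refine Finset.sum_congr rfl fun q _ => ?_
      rw [← Finset.sum_sub_distrib]
      exact Finset.sum_congr rfl fun x _ => by ring
    unfold twistCoeff at h1
    rw [Finset.sum_eq_single_of_mem (n, 0) (by simp), Finset.sum_eq_single_of_mem (m, 0)
      (by simp)] at h1
    · simp at h1
      linarith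
    · rintro ⟨r, i⟩ h2 h3
      rw [Finset.HasAntidiagonal.mem_antidiagonal] at h2
      have : i ≠ 0 := by rintro rfl; exact h3 (by simpa using h2)
      simp only at h2 ⊢
      rw [ih (r + n) (by omega) r n rfl, sub_self, zero_mul]
    · rintro ⟨s, j⟩ h2 h3
      rw [Finset.HasAntidiagonal.mem_antidiagonal] at h2
      have : j ≠ 0 := by rintro rfl; exact h3 (by simpa using h2)
      refine Finset.sum_eq_zero ?_
      rintro ⟨r, i⟩ h4
      rw [Finset.HasAntidiagonal.mem_antidiagonal] at h4
      simp only at h2 h4 ⊢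
      rw [ih (r + s) (by omega) r s rfl, sub_self, zero_mul]

namespace SimpleGraph

/-- The normalized number of bipartite trees. -/
noncomputable def treeCoeff (r s : ℕ) : ℝ :=
  (numTrees r s : ℝ) / ((r.factorial : ℝ) * s.factorial)

theorem treeCoeff_nonneg (r s : ℕ) : 0 ≤ treeCoeff r s := by
  unfold treeCoeff; positivity

theorem numTrees_zero_zero : numTrees 0 0 = 0 := by
  rw [numTrees, Finset.card_eq_zero, Finset.filter_eq_empty_iff]
  intro U hU
  obtain ⟨u⟩ := (mem_connSets.1 hU).nonempty
  rcases u with u | u <;> exact u.elim0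

theorem treePoly_zero (x y : ℝ) : treePoly x y 0 = 0 := by
  simp [treePoly, numTrees_zero_zero]

theorem hasSum_treeCoeff {a b : ℝ} (ha : 0 < a) (hb : 0 < b) :
    HasSum (fun q : ℕ × ℕ => treeCoeff q.1 q.2 *
      ((a * Real.exp (-b)) ^ q.1 * (b * Real.exp (-a)) ^ q.2))
      (treeSum (a * Real.exp (-b)) (b * Real.exp (-a))) := by
  set x := a * Real.exp (-b)
  set y := b * Real.exp (-a)
  have hx : 0 < x := by positivity
  have hy : 0 < y := by positivity
  have hs : HasSum (treePoly x y) (treeSum x y) := by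
    have h1 : HasSum (fun k => treePoly x y (k + 1)) (treeSum x y) :=
      (summable_treePoly ha hb).hasSum
    simpa [treePoly_zero] using (hasSum_nat_add_iff (f := treePoly x y) 1).1 h1
  rw [← (Finset.HasAntidiagonal.sigmaAntidiagonalEquivProd (A := ℕ)).hasSum_iff]
  have hfib : ∀ k, HasSum (fun q : Finset.HasAntidiagonal.antidiagonal k =>
      treeCoeff q.1.1 q.1.2 * (x ^ q.1.1 * y ^ q.1.2)) (treePoly x y k) := by
    intro k
    have := hasSum_fintype (fun q : Finset.HasAntidiagonal.antidiagonal k =>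
      treeCoeff q.1.1 q.1.2 * (x ^ q.1.1 * y ^ q.1.2))
    rwa [Finset.sum_coe_sort (Finset.HasAntidiagonal.antidiagonal k) (fun q : ℕ × ℕ =>
      treeCoeff q.1 q.2 * (x ^ q.1 * y ^ q.2))] at this
  have hnn : ∀ q : ℕ × ℕ, 0 ≤ treeCoeff q.1 q.2 * (x ^ q.1 * y ^ q.2) := fun q =>
    mul_nonneg (treeCoeff_nonneg _ _) (by positivity)
  refine HasSum.sigma_of_hasSum hs hfib ?_
  refine (summable_sigma_of_nonneg fun q => hnn _).2 ⟨fun k => (hfib k).summable, ?_⟩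
  refine hs.summable.congr fun k => ?_
  exact ((hfib k).tsum_eq).symm

/-- The general term of the expansion of the tree series in powers of `a` and `b`. -/
noncomputable def expandTerm (a b : ℝ) (x : (ℕ × ℕ) × (ℕ × ℕ)) : ℝ :=
  treeCoeff x.1.1 x.1.2 * (a ^ x.1.1 * b ^ x.1.2) *
    ((-(x.1.2 * a)) ^ x.2.1 / x.2.1.factorial * ((-(x.1.1 * b)) ^ x.2.2 / x.2.2.factorial))

theorem hasSum_pow_div_factorial_mul (u v : ℝ) :
    HasSum (fun q : ℕ × ℕ => u ^ q.1 / q.1.factorial * (v ^ q.2 / q.2.factorial))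
      (Real.exp u * Real.exp v) := by
  have hu : HasSum (fun k : ℕ => u ^ k / k.factorial) (Real.exp u) := by
    rw [Real.exp_eq_exp_ℝ]; exact NormedSpace.expSeries_div_hasSum_exp u
  have hv : HasSum (fun k : ℕ => v ^ k / k.factorial) (Real.exp v) := by
    rw [Real.exp_eq_exp_ℝ]; exact NormedSpace.expSeries_div_hasSum_exp v
  have hs : Summable fun q : ℕ × ℕ =>
      u ^ q.1 / (q.1.factorial : ℝ) * (v ^ q.2 / (q.2.factorial : ℝ)) :=
    summable_mul_of_summable_norm (f := fun k : ℕ => u ^ k / (k.factorial : ℝ))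
      (g := fun k : ℕ => v ^ k / (k.factorial : ℝ))
      (NormedSpace.norm_expSeries_div_summable u) (NormedSpace.norm_expSeries_div_summable v)
  exact HasSum.mul (f := fun k : ℕ => u ^ k / (k.factorial : ℝ))
    (g := fun k : ℕ => v ^ k / (k.factorial : ℝ)) hu hv hs

/-- Absolute values turn `exp (-δ)` into `exp δ`, so the sum is the tree series at `x = y = δ e^δ`.
It is dominated by the series for `a = b = 1`, where `x = y = e^{-1}`. -/
theorem summable_abs_expandTerm {δ : ℝ} (hδ : 0 < δ) (hδ' : δ * Real.exp δ ≤ Real.exp (-1)) :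
    Summable fun x => |expandTerm δ δ x| := by
  have habs : ∀ x : (ℕ × ℕ) × (ℕ × ℕ), |expandTerm δ δ x| =
      treeCoeff x.1.1 x.1.2 * (δ ^ x.1.1 * δ ^ x.1.2) *
        ((x.1.2 * δ) ^ x.2.1 / x.2.1.factorial * ((x.1.1 * δ) ^ x.2.2 / x.2.2.factorial)) := by
    intro x
    have h0 : 0 ≤ (x.1.2 : ℝ) * δ := by positivity
    have h1 : 0 ≤ (x.1.1 : ℝ) * δ := by positivity
    simp only [expandTerm, abs_mul, abs_div, abs_pow, abs_neg, Nat.abs_cast, abs_of_nonneg hδ.le,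
      abs_of_nonneg (treeCoeff_nonneg _ _)]
  have hfib : ∀ q : ℕ × ℕ, HasSum (fun w => |expandTerm δ δ (q, w)|)
      (treeCoeff q.1 q.2 * (δ ^ q.1 * δ ^ q.2) * (Real.exp (q.2 * δ) * Real.exp (q.1 * δ))) := by
    intro q
    simp only [habs]
    exact (hasSum_pow_div_factorial_mul _ _).mul_left _
  rw [summable_prod_of_nonneg fun x => abs_nonneg _]
  refine ⟨fun q => (hfib q).summable, ?_⟩
  simp only [fun q => (hfib q).tsum_eq]
  have hs := (hasSum_treeCoeff one_pos one_pos).summable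
  refine hs.of_nonneg_of_le (fun q => mul_nonneg (mul_nonneg (treeCoeff_nonneg _ _)
    (by positivity)) (by positivity)) fun q => ?_
  rw [mul_assoc]
  refine mul_le_mul_of_nonneg_left ?_ (treeCoeff_nonneg _ _)
  rw [Real.exp_nat_mul, Real.exp_nat_mul, one_mul]
  calc δ ^ q.1 * δ ^ q.2 * (Real.exp δ ^ q.2 * Real.exp δ ^ q.1)
      = (δ * Real.exp δ) ^ q.1 * (δ * Real.exp δ) ^ q.2 := by rw [mul_pow, mul_pow]; ring
    _ ≤ _ := by gcongr

theorem abs_expandTerm_le {a b δ : ℝ} (ha : 0 < a) (hb : 0 < b) (haδ : a ≤ δ) (hbδ : b ≤ δ)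
    (x : (ℕ × ℕ) × (ℕ × ℕ)) : |expandTerm a b x| ≤ |expandTerm δ δ x| := by
  simp only [expandTerm, abs_mul, abs_div, abs_pow, abs_neg, Nat.abs_cast,
    abs_of_nonneg (treeCoeff_nonneg _ _), abs_of_pos ha, abs_of_pos hb,
    abs_of_pos (ha.trans_le haδ)]
  have := treeCoeff_nonneg x.1.1 x.1.2
  have hδ := ha.trans_le haδ
  gcongr

theorem hasSum_expandTerm {a b δ : ℝ} (ha : 0 < a) (hb : 0 < b) (haδ : a ≤ δ) (hbδ : b ≤ δ)
    (hδ' : δ * Real.exp δ ≤ Real.exp (-1)) (hδ1 : δ < 1) :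
    HasSum (expandTerm a b) (a + b - a * b) := by
  have hδ : 0 < δ := ha.trans_le haδ
  have hs : Summable (expandTerm a b) :=
    Summable.of_norm_bounded (g := fun x => |expandTerm δ δ x|)
      (summable_abs_expandTerm hδ hδ') fun x => abs_expandTerm_le ha hb haδ hbδ x
  have hab : a * b < 1 := by nlinarith
  have hfib : ∀ q : ℕ × ℕ, HasSum (fun w => expandTerm a b (q, w))
      (treeCoeff q.1 q.2 * ((a * Real.exp (-b)) ^ q.1 * (b * Real.exp (-a)) ^ q.2)) := by
    intro q
    have h := (hasSum_pow_div_factorial_mul (-(q.2 * a)) (-(q.1 * b))).mul_left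
      (treeCoeff q.1 q.2 * (a ^ q.1 * b ^ q.2))
    have hv : treeCoeff q.1 q.2 * (a ^ q.1 * b ^ q.2) *
        (Real.exp (-(q.2 * a)) * Real.exp (-(q.1 * b))) =
        treeCoeff q.1 q.2 * ((a * Real.exp (-b)) ^ q.1 * (b * Real.exp (-a)) ^ q.2) := by
      rw [mul_pow, mul_pow, ← Real.exp_nat_mul, ← Real.exp_nat_mul]
      ring_nf
    rwa [hv] at h
  have h1 := hs.hasSum.prod_fiberwise hfib
  have h2 := (hasSum_treeCoeff ha hb).unique h1
  rw [← treeSum_eq ha hb hab, h2]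
  exact hs.hasSum

/-- The right side lists the coefficients of `a + b - a b`. Comparing powers of `a` for fixed `b`,
and then powers of `b`, needs only uniqueness for series in one variable. -/
theorem twistCoeff_treeCoeff (m n : ℕ) : twistCoeff treeCoeff m n =
    if m = 0 then (if n = 1 then 1 else 0) else
      if m = 1 then (if n = 0 then 1 else if n = 1 then -1 else 0) else 0 := by
  obtain ⟨δ, hδ, hδ1, hδ'⟩ : ∃ δ : ℝ, 0 < δ ∧ δ < 1 ∧ δ * Real.exp δ ≤ Real.exp (-1) := by
    have hlim : Tendsto (fun δ : ℝ => δ * Real.exp δ) (𝓝[>] 0) (𝓝 (0 * Real.exp 0)) :=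
      ((continuous_id.mul Real.continuous_exp).tendsto 0).mono_left nhdsWithin_le_nhds
    rw [zero_mul] at hlim
    obtain ⟨δ, h1, h2⟩ := ((hlim.eventually (gt_mem_nhds (Real.exp_pos (-1)))).and
      (Ioo_mem_nhdsGT one_pos)).exists
    exact ⟨δ, h2.1, h2.2, h1.le⟩
  -- the terms grouped as `((r, i), (s, j))`
  let G : ((ℕ × ℕ) × (ℕ × ℕ)) → ℝ := fun y => treeCoeff y.1.1 y.2.1 *
    ((-(y.2.1 : ℝ)) ^ y.1.2 / y.1.2.factorial * ((-(y.1.1 : ℝ)) ^ y.2.2 / y.2.2.factorial))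
  have hG : ∀ (a b : ℝ) (y : (ℕ × ℕ) × (ℕ × ℕ)),
      expandTerm a b (Equiv.prodProdProdComm ℕ ℕ ℕ ℕ y) =
        G y * b ^ (y.2.1 + y.2.2) * a ^ (y.1.1 + y.1.2) := by
    rintro a b ⟨⟨r, i⟩, ⟨s, j⟩⟩
    simp only [expandTerm, G, Equiv.prodProdProdComm_apply, neg_mul_eq_neg_mul, mul_pow, pow_add]
    ring
  have hval : ∀ a b : ℝ, 0 < a → a ≤ δ → 0 < b → b ≤ δ →
      HasSum (fun y => G y * b ^ (y.2.1 + y.2.2) * a ^ (y.1.1 + y.1.2)) (b + (1 - b) * a) := by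
    intro a b ha haδ hb hbδ
    have h := (Equiv.prodProdProdComm ℕ ℕ ℕ ℕ).hasSum_iff.2
      (hasSum_expandTerm ha hb haδ hbδ hδ' hδ1)
    rw [show a + b - a * b = b + (1 - b) * a by ring] at h
    exact h.congr_fun fun y => (hG a b y).symm
  have habs : Summable fun y => |G y| * δ ^ (y.2.1 + y.2.2) * δ ^ (y.1.1 + y.1.2) := by
    have h := (Equiv.prodProdProdComm ℕ ℕ ℕ ℕ).summable_iff.2 (summable_abs_expandTerm hδ hδ')
    refine h.congr fun y => ?_
    rw [Function.comp_apply, hG, abs_mul, abs_mul, abs_of_pos (pow_pos hδ _),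
      abs_of_pos (pow_pos hδ _)]
  have habsb : ∀ b, 0 < b → b ≤ δ →
      Summable fun y => |G y * b ^ (y.2.1 + y.2.2)| * δ ^ (y.1.1 + y.1.2) := by
    intro b hb hbδ
    refine habs.of_nonneg_of_le (fun y => by positivity) fun y => ?_
    rw [abs_mul, abs_of_pos (pow_pos hb _)]
    gcongr
  -- for fixed `b`, compare powers of `a`
  let H : ℝ → ℕ × ℕ → ℝ := fun b x => ∑' q : ℕ × ℕ, G (x, q) * b ^ (q.1 + q.2)
  have hfibs : ∀ b, 0 < b → b ≤ δ → ∀ x : ℕ × ℕ,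
      Summable fun q : ℕ × ℕ => |G (x, q) * b ^ (q.1 + q.2)| := by
    intro b hb hbδ x
    have h := (habsb b hb hbδ).prod_factor x
    refine (summable_mul_right_iff (pow_pos hδ (x.1 + x.2)).ne').1 h
  have hstep1 : ∀ b, 0 < b → b ≤ δ → ∀ m, ∑ x ∈ Finset.HasAntidiagonal.antidiagonal m, H b x =
      if m = 0 then b else if m = 1 then 1 - b else 0 := by
    intro b hb hbδ m
    refine sum_antidiagonal_eq_of_tsum_eq hδ ?_ ?_ m
    · have h := (habsb b hb hbδ).prod
      refine h.of_nonneg_of_le (fun x => by positivity) fun x => ?_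
      change _ ≤ ∑' q : ℕ × ℕ, |G (x, q) * b ^ (q.1 + q.2)| * δ ^ (x.1 + x.2)
      rw [tsum_mul_right]
      gcongr
      have := norm_tsum_le_tsum_norm (f := fun q : ℕ × ℕ => G (x, q) * b ^ (q.1 + q.2))
        (hfibs b hb hbδ x)
      simpa only [Real.norm_eq_abs] using this
    · intro a ha haδ
      have h := hval a b ha haδ hb hbδ
      rw [← h.tsum_eq, h.summable.tsum_prod]
      refine tsum_congr fun x => ?_
      change _ = ∑' q : ℕ × ℕ, G (x, q) * b ^ (q.1 + q.2) * a ^ (x.1 + x.2)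
      rw [tsum_mul_right]
  -- for fixed `m`, compare powers of `b`
  unfold twistCoeff
  have hstep2 := sum_antidiagonal_eq_of_tsum_eq (f := fun q => ∑ x ∈
      Finset.HasAntidiagonal.antidiagonal m, G (x, q)) (δ := δ)
      (P := if m = 1 then 1 else 0) (Q := if m = 0 then 1 else if m = 1 then -1 else 0) hδ ?_ ?_ n
  · refine Eq.trans hstep2 ?_
    split_ifs <;> first | rfl | omega
  · have h : Summable fun q : ℕ × ℕ => ∑ x ∈ Finset.HasAntidiagonal.antidiagonal m,
        |G (x, q) * δ ^ (q.1 + q.2)| := summable_sum fun x _ => hfibs δ hδ le_rfl x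
    refine h.of_nonneg_of_le (fun q => by positivity) fun q => ?_
    simp only [abs_mul, abs_of_pos (pow_pos hδ _)]
    rw [← Finset.sum_mul]
    gcongr
    exact Finset.abs_sum_le_sum_abs _ _
  · intro b hb hbδ
    have h := hstep1 b hb hbδ m
    have h2 : ∑' q : ℕ × ℕ, (∑ x ∈ Finset.HasAntidiagonal.antidiagonal m, G (x, q)) *
        b ^ (q.1 + q.2) = ∑ x ∈ Finset.HasAntidiagonal.antidiagonal m, H b x := by
      simp only [Finset.sum_mul]
      exact Summable.tsum_finsetSum fun x _ => (hfibs b hb hbδ x).of_abs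
    rw [h2, h]
    split_ifs <;> first | omega | ring

/-- Scoins' formula: the complete bipartite graph with classes of sizes `r` and `s` has
`r ^ (s - 1) * s ^ (r - 1)` spanning trees. -/
theorem treeCoeff_eq (r s : ℕ) : treeCoeff r s = scoinsCoeff r s :=
  eq_of_twistCoeff_eq (fun m n => (twistCoeff_treeCoeff m n).trans
    (twistCoeff_scoinsCoeff m n).symm) r s

end SimpleGraph

/-! ### Positivity of the density above the threshold. -/

theorem exists_conjugate {a b : ℝ} (ha : 0 < a) (hb : 0 < b) (hab : 1 < a * b) :
    ∃ P Q : ℝ, 0 < P ∧ 0 < Q ∧ P = b * (1 - Real.exp (-Q)) ∧ Q = a * (1 - Real.exp (-P)) := by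
  -- Eliminating `P` leaves the zeros of `φ`. As `φ 0 = 0` with slope `a b - 1 > 0` there, `φ` is
  -- positive just to the right of zero, and `φ a < 0`. Probabilistically, `exp (-P)` and `exp (-Q)`
  -- are extinction probabilities of the two-type Poisson branching process.
  let φ : ℝ → ℝ := fun Q => a * (1 - Real.exp (-(b * (1 - Real.exp (-Q))))) - Q
  have hφ0 : φ 0 = 0 := by simp [φ]
  have hcont : Continuous φ := by fun_prop
  have hderiv : HasDerivAt φ (a * b - 1) 0 := by
    have h1 : HasDerivAt (fun Q : ℝ => Real.exp (-Q)) (-1) 0 := by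
      simpa using (hasDerivAt_neg (0 : ℝ)).exp
    have h2 := ((((h1.const_sub 1).const_mul b).neg.exp.const_sub 1).const_mul a).sub
      (hasDerivAt_id (0 : ℝ))
    exact HasDerivAt.congr_deriv (f := φ) h2 (by simp)
  obtain ⟨Q₀, hQ₀, hφQ₀⟩ : ∃ Q, Q ∈ Set.Ioo 0 a ∧ 0 < φ Q := by
    have hs := hderiv.tendsto_slope.mono_left
      (nhdsWithin_mono (0 : ℝ) (fun x (hx : x ∈ Set.Ioi 0) => (ne_of_gt hx : x ≠ 0)))
    obtain ⟨Q, h1, h2⟩ := ((hs.eventually (lt_mem_nhds (show 0 < a * b - 1 by linarith))).and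
      (Ioo_mem_nhdsGT ha)).exists
    refine ⟨Q, h2, ?_⟩
    rw [slope_def_field, hφ0, sub_zero, sub_zero] at h1
    exact (div_pos_iff_of_pos_right h2.1).1 h1
  have hφa : φ a < 0 := by
    have : 0 < a * Real.exp (-(b * (1 - Real.exp (-a)))) := by positivity
    simp only [φ]
    linarith
  obtain ⟨Q, hQ, hQφ⟩ := intermediate_value_Icc' hQ₀.2.le hcont.continuousOn
    (show (0 : ℝ) ∈ Set.Icc (φ a) (φ Q₀) from ⟨hφa.le, hφQ₀.le⟩)
  have hQ0 : 0 < Q := hQ₀.1.trans_le hQ.1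
  have hexp : Real.exp (-Q) < 1 := (Real.exp_lt_exp.2 (by linarith)).trans_eq Real.exp_zero
  refine ⟨b * (1 - Real.exp (-Q)), Q, mul_pos hb (by linarith), hQ0, rfl, ?_⟩
  exact (sub_eq_zero.1 hQφ).symm

theorem mul_exp_neg_lt_one_sub {P : ℝ} (hP : 0 < P) :
    P * Real.exp (-P) < 1 - Real.exp (-P) := by
  have h := Real.add_one_lt_exp hP.ne'
  have h2 : Real.exp P * Real.exp (-P) = 1 := by rw [← Real.exp_add]; simp
  nlinarith [Real.exp_pos (-P)]

/-- The integral of the strictly convex `exp (-t)` over `[0, P]` is less than its trapezoidal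
approximation. -/
theorem one_sub_exp_neg_lt {P : ℝ} (hP : 0 < P) :
    1 - Real.exp (-P) < P * (1 - (1 - Real.exp (-P)) / 2) := by
  have h1 : 0 < Real.exp P - 1 := by linarith [Real.add_one_lt_exp hP.ne']
  have h := Real.lt_log_one_add_of_pos h1
  rw [add_sub_cancel, Real.log_exp, div_lt_iff₀ (by linarith)] at h
  have h2 : Real.exp P * Real.exp (-P) = 1 := by rw [← Real.exp_add]; simp
  nlinarith [Real.exp_pos (-P)]

namespace SimpleGraph

/-- The conjugate pair `a' = a e^{-P}`, `b' = b e^{-Q}` gives the same `x` and `y` and satisfies `a'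
b' < 1`, so the closed form applies to it. With `u = e^{-P}`, `w = e^{-Q}` the claim reads `a (1 -
u) + b (1 - w) < a b (1 - u w)`: the sum of the trapezoidal inequalities for `P` and `Q`, multiplied
by `a` and `b`. -/
theorem cyclomatic_density_pos {a b : ℝ} (ha : 0 < a) (hb : 0 < b) (hab : 1 < a * b) :
    0 < a * b - (a + b) + treeSum (a * Real.exp (-b)) (b * Real.exp (-a)) := by
  obtain ⟨P, Q, hP, hQ, hPQ, hQP⟩ := exists_conjugate ha hb hab
  have eP := Real.exp_pos (-P)
  have eQ := Real.exp_pos (-Q)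
  have hx : a * Real.exp (-P) * Real.exp (-(b * Real.exp (-Q))) = a * Real.exp (-b) := by
    rw [mul_assoc, ← Real.exp_add]
    congr 2
    linarith
  have hy : b * Real.exp (-Q) * Real.exp (-(a * Real.exp (-P))) = b * Real.exp (-a) := by
    rw [mul_assoc, ← Real.exp_add]
    congr 2
    linarith
  have h1 := mul_exp_neg_lt_one_sub hP
  have h2 := mul_exp_neg_lt_one_sub hQ
  have hlt : a * Real.exp (-P) * (b * Real.exp (-Q)) < 1 := by
    have h3 : 0 < P * Real.exp (-P) := by positivity
    have h4 : 0 < Q * Real.exp (-Q) := by positivity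
    have hPQpos : 0 < P * Q := mul_pos hP hQ
    have h5 : (P * Real.exp (-P)) * (Q * Real.exp (-Q)) <
        (1 - Real.exp (-P)) * (1 - Real.exp (-Q)) := by
      apply mul_lt_mul'' h1 h2 h3.le h4.le
    have h6 : a * b * ((1 - Real.exp (-P)) * (1 - Real.exp (-Q))) = P * Q := by
      rw [show a * b * ((1 - Real.exp (-P)) * (1 - Real.exp (-Q))) =
        (b * (1 - Real.exp (-Q))) * (a * (1 - Real.exp (-P))) by ring, ← hPQ, ← hQP]
    have h7 := mul_lt_mul_of_pos_left h5 (mul_pos ha hb)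
    rw [h6] at h7
    have h8 : P * Q * (a * Real.exp (-P) * (b * Real.exp (-Q))) < P * Q * 1 := by
      linarith
    exact lt_of_mul_lt_mul_left h8 hPQpos.le
  have hsum := treeSum_eq (mul_pos ha eP) (mul_pos hb eQ) hlt
  rw [hx, hy] at hsum
  rw [hsum]
  have h3 := mul_lt_mul_of_pos_left (one_sub_exp_neg_lt hP) ha
  have h4 := mul_lt_mul_of_pos_left (one_sub_exp_neg_lt hQ) hb
  set u := Real.exp (-P)
  set w := Real.exp (-Q)
  have e1 : a * (P * (1 - (1 - u) / 2)) = a * P - P * Q / 2 := by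
    have : a * (P * (1 - (1 - u) / 2)) = a * P - P * (a * (1 - u)) / 2 := by ring
    rw [this, ← hQP]
  have e2 : b * (Q * (1 - (1 - w) / 2)) = b * Q - P * Q / 2 := by
    have : b * (Q * (1 - (1 - w) / 2)) = b * Q - Q * (b * (1 - w)) / 2 := by ring
    rw [this, ← hPQ]
    ring
  rw [e1] at h3
  rw [e2] at h4
  have e3 : a * P = a * b * (1 - w) := by rw [mul_assoc, ← hPQ]
  have e4 : b * Q = a * b * (1 - u) := by rw [mul_comm a b, mul_assoc, ← hQP]
  have e5 : P * Q = a * b * ((1 - u) * (1 - w)) := by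
    have : a * b * ((1 - u) * (1 - w)) = (b * (1 - w)) * (a * (1 - u)) := by ring
    rw [this, ← hPQ, ← hQP]
  nlinarith

/-! ### The constant `gammaConst` and convergence of the genus. -/

theorem gammaTerm_eq_treePoly (d l : ℝ) (k : ℕ) :
    gammaTerm d l k = treePoly (d * √l * Real.exp (-(d / √l)))
      (d / √l * Real.exp (-(d * √l))) k := by
  unfold gammaTerm treePoly
  rw [Finset.mul_sum]
  refine Finset.sum_congr rfl fun q hq => ?_
  have hq' := Finset.HasAntidiagonal.mem_antidiagonal.1 hq
  have h1 := treeCoeff_eq q.1 q.2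
  rw [treeCoeff, scoinsCoeff] at h1
  rw [h1, ← hq', pow_add]
  -- Here `a = d √l` and `b = d / √l`. Both arguments `a e^{-b}` and `b e^{-a}` contain the factor
  -- `(d / √l) e^{-d/√l}`, which comes out with exponent `r + s = k`.
  have hx : d * √l * Real.exp (-(d / √l)) = d / √l * Real.exp (-(d / √l)) * l := by
    rw [show d / √l * Real.exp (-(d / √l)) * l = d * (l / √l) * Real.exp (-(d / √l)) by ring,
      Real.div_sqrt]
  have hy : d / √l * Real.exp (-(d * √l)) =
      d / √l * Real.exp (-(d / √l)) * Real.exp (-(d * (l - 1) / √l)) := by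
    rw [mul_assoc, ← Real.exp_add]
    congr 2
    rw [show -(d / √l) + -(d * (l - 1) / √l) = -(d * (l / √l)) by ring, Real.div_sqrt]
  have he : Real.exp (-(d * (l - 1) / √l) * q.2) = Real.exp (-(d * (l - 1) / √l)) ^ q.2 := by
    rw [← Real.exp_nat_mul, mul_comm]
  rw [hx, hy, he, mul_pow (d / √l * Real.exp (-(d / √l))) l,
    mul_pow (d / √l * Real.exp (-(d / √l))) (Real.exp _)]
  ring

theorem gammaConst_eq {d l : ℝ} (hd : 0 < d) (hl : 0 < l) :
    gammaConst d l = (d * √l * (d / √l) - (d * √l + d / √l) +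
      treeSum (d * √l * Real.exp (-(d / √l))) (d / √l * Real.exp (-(d * √l)))) /
        (2 * d ^ 2) := by
  have hs : 0 < √l := Real.sqrt_pos.2 hl
  have hsq : √l * √l = l := Real.mul_self_sqrt hl.le
  unfold gammaConst treeSum
  simp only [gammaTerm_eq_treePoly]
  generalize (∑' k, treePoly (d * √l * Real.exp (-(d / √l)))
    (d / √l * Real.exp (-(d * √l))) (k + 1)) = T
  nth_rewrite 1 [← hsq]
  field_simp

/-- Convergence in mean. The five errors are the fluctuation of `β` (Efron–Stein), the bias of its
mean, the rounding, the short cycles, and the long faces. For fixed `L` all but the last tend to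
zero, and the last tends to `2 a b / L`, so `L` is chosen before `i`. -/
theorem SparseRegime.tendsto_genus {n m : ℕ → ℕ} {p : ℕ → ℝ} {a b : ℝ}
    (h : SparseRegime n m p a b) (ha : 0 < a) (hb : 0 < b) :
    Tendsto (fun i => graphExp (p i) (n i) (m i) (fun S => |2 * p i * (bip S).genus -
      (a * b - (a + b) + treeSum (a * Real.exp (-b)) (b * Real.exp (-a)))|)) atTop (𝓝 0) := by
  set N := a * b - (a + b) + treeSum (a * Real.exp (-b)) (b * Real.exp (-a)) with hN
  let Eβ : ℕ → ℝ := fun i => graphExp (p i) (n i) (m i) (fun S => ((bip S).cyclomatic : ℝ))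
  have hbound : ∀ L : ℕ, 0 < L → ∀ i, graphExp (p i) (n i) (m i)
      (fun S => |2 * p i * (bip S).genus - N|) ≤
      √(p i * ((n i : ℝ) * m i * p i ^ 2)) + |p i * Eβ i - N| + p i +
        2 * (p i * graphExp (p i) (n i) (m i) (fun S => ((shortEdges S L).card : ℝ))) +
        2 / L * ((n i : ℝ) * m i * p i ^ 2) := by
    intro L hL i
    have hp := h.nonneg i
    have hpt : ∀ S ⊆ (Finset.univ : Finset (Fin (n i) × Fin (m i))),
        |2 * p i * (bip S).genus - N| ≤ p i * |((bip S).cyclomatic : ℝ) - Eβ i| +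
          (|p i * Eβ i - N| + (p i + (2 * p i * ((shortEdges S L).card : ℝ) +
            2 / L * p i * (S.card : ℝ)))) := by
      intro S _
      have h1 := (bip S).two_mul_genus_le (cyclomatic_bip_nonneg S)
      have h2 := (bip S).le_two_mul_genus L hL
      have h3 : (Nat.card {a // (bip S).IsShortCyclic L a} : ℝ) ≤ 2 * (shortEdges S L).card := by
        exact_mod_cast card_isShortCyclic_le S L
      rw [card_edgeSet_bip] at h2
      have h4 : 2 * p i * (bip S).genus - N = p i * (((bip S).cyclomatic : ℝ) - Eβ i) +
          (p i * Eβ i - N) + p i * (2 * (bip S).genus - (bip S).cyclomatic) := by ring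
      have h5 : |(2 * (bip S).genus - (bip S).cyclomatic : ℝ)| ≤
          1 + (2 * ((shortEdges S L).card : ℝ) + 2 / L * (S.card : ℝ)) := by
        have h6 : 2 * (S.card : ℝ) / L = 2 / L * S.card := by ring
        have h7 : 0 ≤ 2 / (L : ℝ) * S.card := by positivity
        have h8 : 0 ≤ ((shortEdges S L).card : ℝ) := by positivity
        rw [abs_le]
        constructor <;> linarith
      rw [h4]
      refine (abs_add_three _ _ _).trans ?_
      rw [abs_mul, abs_mul, abs_of_nonneg hp]
      have := mul_le_mul_of_nonneg_left h5 hp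
      linarith
    refine (bernoulliExp_mono hp (h.le_one i) hpt).trans ?_
    rw [bernoulliExp_add, bernoulliExp_add, bernoulliExp_add, bernoulliExp_add,
      bernoulliExp_const_mul, bernoulliExp_const_mul, bernoulliExp_const_mul, bernoulliExp_const,
      bernoulliExp_const, bernoulliExp_card]
    have hv := bernoulliExp_abs_sub_le hp (h.le_one i)
      (Finset.univ : Finset (Fin (n i) × Fin (m i))) (fun S => ((bip S).cyclomatic : ℝ))
      (fun S e he => by
        have h1 : ((bip S).cyclomatic : ℝ) ≤ (bip (insert e S)).cyclomatic := by
          exact_mod_cast cyclomatic_bip_le_insert he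
        have h2 : ((bip (insert e S)).cyclomatic : ℝ) ≤ (bip S).cyclomatic + 1 := by
          exact_mod_cast cyclomatic_bip_insert_le he
        rw [abs_le]
        constructor <;> linarith)
    have hc : (((Finset.univ : Finset (Fin (n i) × Fin (m i))).card : ℕ) : ℝ) = n i * m i := by
      simp
    rw [hc] at hv ⊢
    have hv' := mul_le_mul_of_nonneg_left hv hp
    have hsqrt : p i * √(p i * (n i * m i)) = √(p i * ((n i : ℝ) * m i * p i ^ 2)) := by
      conv_rhs => rw [show p i * ((n i : ℝ) * m i * p i ^ 2) = p i ^ 2 * (p i * (n i * m i)) by ring,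
        Real.sqrt_mul (by positivity), Real.sqrt_sq hp]
    rw [hsqrt] at hv'
    have : 2 / (L : ℝ) * p i * (p i * (n i * m i)) = 2 / L * ((n i : ℝ) * m i * p i ^ 2) := by ring
    linarith
  have hlim : ∀ L : ℕ, Tendsto (fun i => √(p i * ((n i : ℝ) * m i * p i ^ 2)) +
      |p i * Eβ i - N| + p i +
        2 * (p i * graphExp (p i) (n i) (m i) (fun S => ((shortEdges S L).card : ℝ))) +
        2 / L * ((n i : ℝ) * m i * p i ^ 2)) atTop (𝓝 (2 / L * (a * b))) := by
    intro L
    have h1 : Tendsto (fun i => √(p i * ((n i : ℝ) * m i * p i ^ 2))) atTop (𝓝 √(0 * (a * b))) :=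
      (Real.continuous_sqrt.tendsto _).comp (h.tendsto_p.mul h.tendsto_sq)
    have h2 : Tendsto (fun i => |p i * Eβ i - N|) atTop (𝓝 |N - N|) :=
      ((h.tendsto_cyclomatic ha hb).sub_const N).abs
    have h3 := (((h1.add h2).add h.tendsto_p).add
      ((h.tendsto_shortEdges L).const_mul 2)).add (h.tendsto_sq.const_mul (2 / (L : ℝ)))
    simpa using h3
  rw [Metric.tendsto_atTop]
  intro ε hε
  obtain ⟨L, hL⟩ := exists_nat_gt (2 * (a * b) / ε)
  have hLpos : 0 < (L : ℝ) := lt_of_le_of_lt (by positivity) hL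
  have hLε : 2 / (L : ℝ) * (a * b) < ε := by
    rw [div_lt_iff₀ hε] at hL
    rw [div_mul_eq_mul_div, div_lt_iff₀ hLpos]
    linarith
  obtain ⟨i₀, hi₀⟩ := eventually_atTop.1 ((hlim L).eventually (gt_mem_nhds hLε))
  refine ⟨i₀, fun i hi => ?_⟩
  have hnn : 0 ≤ graphExp (p i) (n i) (m i) (fun S => |2 * p i * (bip S).genus - N|) := by
    rw [graphExp, ← bernoulliExp_const (p := p i)
      (E := (Finset.univ : Finset (Fin (n i) × Fin (m i)))) 0]
    exact bernoulliExp_mono (h.nonneg i) (h.le_one i) fun S _ => abs_nonneg _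
  rw [Real.dist_eq, sub_zero, abs_of_nonneg hnn]
  exact (hbound L (by exact_mod_cast hLpos) i).trans_lt (hi₀ i hi)

theorem sparseRegime_of_eq {d l : ℝ} (hd : 0 < d) (hl : 0 < l) {n₁ n₂ : ℕ → ℕ}
    (hn : ∀ i, (n₁ i : ℝ) = l * (n₂ i : ℝ)) (hn₁ : Tendsto n₁ atTop atTop) {p : ℕ → unitInterval}
    (hp : ∀ᶠ i in atTop, (p i : ℝ) = d / √((n₁ i : ℝ) * (n₂ i : ℝ))) :
    SparseRegime n₁ n₂ (fun i => p i) (d * √l) (d / √l) := by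
  have hs : 0 < √l := Real.sqrt_pos.2 hl
  have hsq : √l * √l = l := Real.mul_self_sqrt hl.le
  have hcast : Tendsto (fun i => (n₁ i : ℝ)) atTop atTop :=
    tendsto_natCast_atTop_atTop.comp hn₁
  have hn2 : ∀ i, (n₂ i : ℝ) = n₁ i / l := fun i => by rw [hn i]; field_simp
  have hcast2 : Tendsto (fun i => (n₂ i : ℝ)) atTop atTop := by
    simp only [hn2]
    exact hcast.atTop_div_const hl
  have hval : ∀ᶠ i in atTop, (p i : ℝ) = d * √l / n₁ i ∧ (n₁ i : ℝ) ≠ 0 := by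
    filter_upwards [hp, hcast.eventually_gt_atTop 0] with i hi hpos
    refine ⟨?_, hpos.ne'⟩
    have h1 : √((n₁ i : ℝ) * (n₂ i : ℝ)) = n₁ i / √l := by
      rw [Real.sqrt_eq_iff_mul_self_eq (by positivity) (by positivity), hn2 i,
        div_mul_div_comm, hsq, mul_div_assoc]
    rw [hi, h1, div_div_eq_mul_div]
  refine ⟨fun i => (p i).2.1, fun i => (p i).2.2, ?_, ?_, ?_, hn₁, ?_⟩
  · exact (hcast.const_div_atTop (d * √l)).congr' (hval.mono fun i hi => hi.1.symm)
  · refine tendsto_const_nhds.congr' (hval.mono fun i hi => ?_)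
    have := hi.2
    change _ = (p i : ℝ) * n₁ i
    rw [hi.1]
    field_simp
  · refine tendsto_const_nhds.congr' (hval.mono fun i hi => ?_)
    have := hi.2
    change _ = (p i : ℝ) * n₂ i
    rw [hi.1, hn2 i, show d * √l / n₁ i * (n₁ i / l) = d * (√l / l) by field_simp,
      Real.sqrt_div_self]
    rfl
  · exact tendsto_natCast_atTop_iff.1 hcast2

end SimpleGraph

open SimpleGraph in
theorem theorem1p4 (d l : ℝ) (hd : 1 < d) (hl0 : 0 < l) (hl1 : l ≤ 1)
    (n₁ n₂ : ℕ → ℕ) (hn : ∀ i, (n₁ i : ℝ) = l * (n₂ i : ℝ)) (hn₁ : Tendsto n₁ atTop atTop)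
    (p : ℕ → unitInterval)
    (hp : ∀ᶠ i in atTop, (p i : ℝ) = d / √((n₁ i : ℝ) * (n₂ i : ℝ))) :
    Summable (fun k : ℕ => gammaTerm d l (k + 1)) ∧
    ∀ ε : ℝ, 0 < ε →
      Tendsto
        (fun i => (binomialRandomBipartite (n₁ i) (n₂ i) (p i)).real
          {G | |(G.genus : ℝ) - gammaConst d l * ((p i : ℝ) * n₁ i * n₂ i)| ≤
            ε * (gammaConst d l * ((p i : ℝ) * n₁ i * n₂ i))})
        atTop (𝓝 1) := by
  classical
  have hd0 : 0 < d := one_pos.trans hd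
  have hs : 0 < √l := Real.sqrt_pos.2 hl0
  have ha : 0 < d * √l := by positivity
  have hb : 0 < d / √l := by positivity
  have hab : d * √l * (d / √l) = d ^ 2 := by field_simp
  refine ⟨by simpa only [gammaTerm_eq_treePoly] using summable_treePoly ha hb, fun ε hε => ?_⟩
  have hreg := sparseRegime_of_eq hd0 hl0 hn hn₁ hp
  -- This is where `d > 1` enters, as `a b = d ^ 2 > 1`.
  have hpos := cyclomatic_density_pos ha hb (by rw [hab]; nlinarith)
  have hγ := gammaConst_eq hd0 hl0
  have hE := hreg.tendsto_genus ha hb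
  set N := d * √l * (d / √l) - (d * √l + d / √l) +
      treeSum (d * √l * Real.exp (-(d / √l))) (d / √l * Real.exp (-(d * √l))) with hN
  have hlow : Tendsto (fun i => 1 - graphExp (p i) (n₁ i) (n₂ i)
      (fun S => |2 * (p i : ℝ) * (bip S).genus - N|) / (ε * N)) atTop (𝓝 1) := by
    simpa using (hE.div_const (ε * N)).const_sub 1
  refine tendsto_of_tendsto_of_tendsto_of_le_of_le' hlow tendsto_const_nhds ?_ ?_
  · filter_upwards [hp, hn₁.eventually_gt_atTop 0] with i hi hi0
    have hn1pos : 0 < (n₁ i : ℝ) := by exact_mod_cast hi0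
    have hn2pos : 0 < (n₂ i : ℝ) := by
      have := hn i
      by_contra hle
      nlinarith
    have hppos : 0 < (p i : ℝ) := by rw [hi]; positivity
    have hp2 : (p i : ℝ) * ((p i : ℝ) * n₁ i * n₂ i) = d ^ 2 := by
      have : (p i : ℝ) * ((p i : ℝ) * n₁ i * n₂ i) = (p i : ℝ) ^ 2 * (n₁ i * n₂ i) := by ring
      rw [this, hi, div_pow, Real.sq_sqrt (by positivity)]
      field_simp
    -- Scaled by `2p`, the predicted genus is exactly `N`. The event becomes `|2 p g - N| ≤ ε N`,
    -- and Markov's inequality with threshold `ε N > 0` applies.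
    have hM : 2 * (p i : ℝ) * (gammaConst d l * ((p i : ℝ) * n₁ i * n₂ i)) = N := by
      rw [hγ, show 2 * (p i : ℝ) * (N / (2 * d ^ 2) * ((p i : ℝ) * n₁ i * n₂ i)) =
        2 * (N / (2 * d ^ 2)) * ((p i : ℝ) * ((p i : ℝ) * n₁ i * n₂ i)) by ring, hp2]
      field_simp
    rw [binomialRandomBipartite_real]
    refine bernoulliExp_markov (p i).2.1 (p i).2.2 (fun S _ => abs_nonneg _) (mul_pos hε hpos)
      (fun S => bip S ∈ {G : SimpleGraph (Fin (n₁ i) ⊕ Fin (n₂ i)) |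
        |(G.genus : ℝ) - gammaConst d l * ((p i : ℝ) * n₁ i * n₂ i)| ≤
            ε * (gammaConst d l * ((p i : ℝ) * n₁ i * n₂ i))}) fun S _ hS => ?_
    have hS' : ε * (gammaConst d l * ((p i : ℝ) * n₁ i * n₂ i)) <
        |((bip S).genus : ℝ) - gammaConst d l * ((p i : ℝ) * n₁ i * n₂ i)| := not_le.1 hS
    have h2p : 0 < 2 * (p i : ℝ) := by positivity
    have h3 := mul_lt_mul_of_pos_left hS' h2p
    rw [← abs_of_pos h2p, ← abs_mul, abs_of_pos h2p, mul_sub, hM, mul_left_comm, hM] at h3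
    exact h3.le
  · refine Eventually.of_forall fun i => ?_
    rw [binomialRandomBipartite_real]
    refine (bernoulliExp_mono (p i).2.1 (p i).2.2 (g := fun _ => 1) fun S _ => ?_).trans
      (bernoulliExp_const 1).le
    split_ifs <;> norm_num
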